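/- Let $\mathcal W\subseteq\mathbb R^d$ be a non-empty bounded polyhedron, let $z$ be a random variable with distribution $\mathbb P$, let $f(w,z)$ be integrable in $z$ for each $w\in\mathcal W$, and suppose that $P(w)=\mathbb E_{z\sim\mathbb P}[f(w,z)]$ is piecewise linear on $\mathcal W$ (i.e. $\mathcal W$ is covered by finitely many polyhedra, and $P$ is affine on the part of $\mathcal W$ in each of them). Let $P_*=\min_{\mathcal W}P$ and $\mathcal W_*=\arg\min_{\mathcal W}P$, and for $w\in\mathcal W$ let $w^*$ be a point of $\mathcal W_*$ closest to $w$ in the Euclidean norm. Let $z_1,z_2,\dots$ be i.i.d. samples from $\mathbb P$. (1) There is $\kappa>0$ with $\|w-w^*\|_2\le\kappa\,(P(w)-P_*)$ for all $w\in\mathcal W$ (weak sharp minima), and there is $\alpha>0$ with $\|w-w^*\|_2^2\le\alpha\,(P(w)-P_*)$ for all $w\in\mathcal W$, i.e. the problem satisfies EBC$(\theta=1,\alpha)$. Suppose in addition that $|f(w,z)-f(u,z)|\le G\|w-u\|_2$ for all $w,u\in\mathcal W$ and all $z$, where $G>0$, and let $\delta\in(0,1)$. Let $R$ be such that $\|w\|_2\le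 R$ on $\mathcal W$. (2) ERM, rate $\widetilde O(d/n)$. If EBC$(1,\alpha)$ holds and $n\ge2$, then with probability at least $1-\delta$ every minimizer $\widehat w$ over $\mathcal W$ of $P_n(w)=\frac1n\sum_{i=1}^n f(w,z_i)$ satisfies $$P(\widehat w)-P_*\le C_1\,\frac{d\log n+\log(1/\delta)}{n},$$ where $C_1$ depends only on $\alpha,G,R$. (3) ASA, rate $\widetilde O(1/n)$. Assume that $P$ is convex and that EBC$(1,\alpha)$ holds. Let $g(w,z)$ be a measurable stochastic subgradient with $\|g\|_2\le G$: for each $w\in\mathcal W$, $g(w,z)$ is a subgradient of $f(\cdot,z)$ at $w$ for all $z$ or, more generally, $\mathbb E_z[g(w,z)]$ is a subgradient of $P$ at $w$ (subgradients relative to $\mathcal W$; in the regular sense for a non-convex function). For $n\ge100$, $w_1\in\mathcal W$ and $\|w_1-w_1^*\|_2\le R_0$, put $m=\lfloor\frac12\log_2\frac{2n}{\log_2 n}\rfloor-1$, $n_0=\lfloor n/m\rfloor$, $\widehat w_0=w_1$. In stage $k=1,\dots,m$, with $R_{k-1}=R_0/2^{k-1}$ and $\gamma_k=R_{k-1}/(G\sqrt{n_0+1})$,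 run $n_0$ steps $v_{t+1}=\Pi(v_t-\gamma_k g(v_t,z))$ from $v_1=\widehat w_{k-1}$, each with a fresh sample $z$, where $\Pi$ is the Euclidean projection onto $\mathcal W\cap\{u:\|u-\widehat w_{k-1}\|_2\le R_{k-1}\}$, and let $\widehat w_k=\frac1{n_0+1}\sum_{t=1}^{n_0+1}v_t$. Then with probability at least $1-\delta$ $$P(\widehat w_m)-P_*\le C_2\max(\alpha G^2,R_0G)\,\frac{\log n\,\log(\log n/\delta)}{n},$$ where $C_2$ is an absolute constant. (4) ERM with non-negative linear losses, rate $\widetilde O((d/n)^2+dP_*/n)$. If moreover $f(w,z)\ge0$ on $\mathcal W$ and each $f(\cdot,z)$ is affine on $\mathcal W$, and if $n\ge2$ and $n\ge C_3\,d\log n$, then with probability at least $1-\delta$ every minimizer $\widehat w$ of $P_n$ over $\mathcal W$ satisfies $$P(\widehat w)-P_*\le C_3\left(\Big(\frac{d\log n+\log(1/\delta)}{n}\Big)^2+\frac{(d\log n+\log(1/\delta))P_*}{n}\right),$$ where $C_3$ depends only on $G,R$ and a constant $\kappa$ as in (1). -/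

import Mathlib

open MeasureTheory

noncomputable section

namespace FastRates

variable {E : Type*} [NormedAddCommGroup E] [InnerProductSpace ℝ E]
variable {Z : Type*} [MeasurableSpace Z]

/-- A polyhedron: the solution set of finitely many linear inequalities. -/
def IsPolyhedron (S : Set E) : Prop :=
  ∃ (m : ℕ) (a : Fin m → E) (b : Fin m → ℝ), S = {w | ∀ i, inner ℝ (a i) w ≤ b i}

/-- `h` agrees on `S` with an affine function. -/
def IsAffineOn (h : E → ℝ) (S : Set E) : Prop :=
  ∃ (a : E) (b : ℝ), ∀ w ∈ S, h w = inner ℝ a w + b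

/-- `h` is piecewise linear on `W`: finitely many polyhedra cover `W`, and `h` is affine on the
part of `W` in each of them. -/
def IsPiecewiseLinearOn (h : E → ℝ) (W : Set E) : Prop :=
  ∃ (N : ℕ) (Q : Fin N → Set E), (∀ j, IsPolyhedron (Q j)) ∧ W ⊆ ⋃ j, Q j ∧
    ∀ j, IsAffineOn h (W ∩ Q j)

/-- The risk `P(w) = 𝔼[f(w, z)]`, `z ∼ μ`. -/
def risk (μ : Measure Z) (f : E → Z → ℝ) (w : E) : ℝ := ∫ z, f w z ∂μ

/-- The empirical risk `P_n(w)` of the first `n` samples. -/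
def empRisk (f : E → Z → ℝ) (n : ℕ) (z : ℕ → Z) (w : E) : ℝ :=
  (1 / (n : ℝ)) * ∑ i ∈ Finset.range n, f w (z i)

/-- The set of minimizers of `h` over `W`. -/
def argminOn (h : E → ℝ) (W : Set E) : Set E := {w | w ∈ W ∧ ∀ u ∈ W, h w ≤ h u}

/-- The optimal value of `h` over `W`. -/
def minValue (h : E → ℝ) (W : Set E) : ℝ := sInf (h '' W)

/-- `y` is a point of `K` closest to `x`. -/
def IsNearest (K : Set E) (x y : E) : Prop := y ∈ K ∧ ∀ u ∈ K, ‖x - y‖ ≤ ‖x - u‖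

/-- The error bound condition EBC(θ, α) for minimizing `P` over `W`: for each `w ∈ W` there is
a minimizer `v` closest to `w`, and `‖w - v‖² ≤ α (P(w) - P(v))^θ`. -/
def EBC (P : E → ℝ) (W : Set E) (θ α : ℝ) : Prop :=
  ∀ w ∈ W, ∃ v, IsNearest (argminOn P W) w v ∧ ‖w - v‖ ^ 2 ≤ α * (P w - P v) ^ θ

/-- Weak sharp minima with modulus `κ`: for each `w ∈ W` there is a minimizer `v` closest to
`w`, and `‖w - v‖ ≤ κ (P(w) - P(v))`. -/
def WeakSharpMinima (P : E → ℝ) (W : Set E) (κ : ℝ) : Prop :=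
  ∀ w ∈ W, ∃ v, IsNearest (argminOn P W) w v ∧ ‖w - v‖ ≤ κ * (P w - P v)

/-- The loss is `G`-Lipschitz in `w ∈ W`, for each data point. -/
def IsLipschitzLoss (f : E → Z → ℝ) (W : Set E) (G : ℝ) : Prop :=
  ∀ z, ∀ w ∈ W, ∀ u ∈ W, |f w z - f u z| ≤ G * ‖w - u‖

/-- The (regular) subdifferential at `w` of a function on `W`, convex or not. For a convex
function on a convex `W` these are the usual subgradients,
`h(u) ≥ h(w) + ⟨v, u - w⟩` for all `u ∈ W`; see `mem_subdiff_iff`. -/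
def subdiff (h : E → ℝ) (W : Set E) (w : E) : Set E :=
  {v | ∀ ε > 0, ∀ᶠ u in nhdsWithin w W, h w + inner ℝ v (u - w) - ε * ‖u - w‖ ≤ h u}

theorem mem_subdiff_iff {h : E → ℝ} {W : Set E} (hh : ConvexOn ℝ W h) {w v : E} (hw : w ∈ W) :
    v ∈ subdiff h W w ↔ ∀ u ∈ W, h w + inner ℝ v (u - w) ≤ h u := by
  constructor
  · intro hv u hu
    refine le_of_forall_pos_le_add fun η hη => ?_
    have hε : 0 < η / (‖u - w‖ + 1) := by positivity
    have htend : Filter.Tendsto (fun t : ℝ => w + t • (u - w)) (nhdsWithin 0 (Set.Ioo 0 1))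
        (nhdsWithin w W) := by
      refine tendsto_nhdsWithin_iff.2 ⟨?_, ?_⟩
      · have hc : Continuous fun t : ℝ => w + t • (u - w) := by fun_prop
        have := hc.tendsto 0
        simp only [zero_smul, add_zero] at this
        exact this.mono_left nhdsWithin_le_nhds
      · filter_upwards [self_mem_nhdsWithin] with t ht
        exact hh.1.add_smul_sub_mem hw hu ⟨ht.1.le, ht.2.le⟩
    have hne : (nhdsWithin (0 : ℝ) (Set.Ioo 0 1)).NeBot :=
      mem_closure_iff_nhdsWithin_neBot.1 (by rw [closure_Ioo (by norm_num)]; simp)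
    obtain ⟨t, ht, htm⟩ := ((htend.eventually (hv _ hε)).and self_mem_nhdsWithin).exists
    simp only [add_sub_cancel_left, inner_smul_right, norm_smul, Real.norm_eq_abs,
      abs_of_pos htm.1] at ht
    have hcv := hh.2 hw hu (by linarith [htm.2] : 0 ≤ 1 - t) htm.1.le (by ring)
    have he : (1 - t) • w + t • u = w + t • (u - w) := by module
    rw [he] at hcv
    simp only [smul_eq_mul] at hcv
    have hb : η / (‖u - w‖ + 1) * ‖u - w‖ ≤ η := by
      rw [div_mul_eq_mul_div, div_le_iff₀ (by positivity)]
      nlinarith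
    have h1 : t * (h w + inner ℝ v (u - w) - η / (‖u - w‖ + 1) * ‖u - w‖) ≤ t * h u := by
      nlinarith
    have h2 := le_of_mul_le_mul_left h1 htm.1
    linarith
  · intro hv ε hε
    filter_upwards [self_mem_nhdsWithin] with u hu
    have := hv u hu
    have := mul_nonneg hε.le (norm_nonneg (u - w))
    linarith

/-- A measurable stochastic subgradient oracle `g` for minimizing `𝔼[f(w, z)]` over `W`, with
norm at most `G`. At each `w ∈ W`, either `g(w, z)` is a subgradient of `f(·, z)` for each `z`
or, more generally, `g(w, z)` is an unbiased estimate of a subgradient of the risk. -/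
def IsSubgradientOracle [MeasurableSpace E] (μ : Measure Z) (f : E → Z → ℝ) (W : Set E) (G : ℝ)
    (g : E → Z → E) : Prop :=
  Measurable (Function.uncurry g) ∧ ∀ w ∈ W, (∀ z, ‖g w z‖ ≤ G) ∧
    ((∀ z, g w z ∈ subdiff (fun u => f u z) W w) ∨
      (∫ z, g w z ∂μ) ∈ subdiff (risk μ f) W w)

open Classical in
/-- Euclidean projection of `x` onto `K` (a closest point, if there is one). -/
def proj (K : Set E) (x : E) : E := if h : ∃ y, IsNearest K x y then h.choose else x

/-- The iterates of the projected stochastic subgradient method on `K` with step size `γ`,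
started at `w₁` (index `0` here). -/
def ssgIter (g : E → Z → E) (K : Set E) (γ : ℝ) (w₁ : E) (z : ℕ → Z) : ℕ → E
  | 0 => w₁
  | t + 1 => proj K (ssgIter g K γ w₁ z t - γ • g (ssgIter g K γ w₁ z t) (z t))

/-- The method SSG: the average of the first iterate and the `T` following ones. -/
def ssg (g : E → Z → E) (K : Set E) (γ : ℝ) (w₁ : E) (z : ℕ → Z) (T : ℕ) : E :=
  (1 / ((T : ℝ) + 1)) • ∑ t ∈ Finset.range (T + 1), ssgIter g K γ w₁ z t

/-- The number of stages `m = ⌊(1/2) log₂ (2n / log₂ n)⌋ - 1` of ASA. -/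
def asaStages (n : ℕ) : ℕ := ⌊(1 / 2) * Real.logb 2 (2 * n / Real.logb 2 n)⌋₊ - 1

/-- The number of steps `n₀ = ⌊n / m⌋` in a stage. -/
def asaSteps (n : ℕ) : ℕ := n / asaStages n

/-- The point reached after `k` stages of ASA. The stage that follows it has radius `R₀ / 2 ^ k`,
step size `R₀ / 2 ^ k / (G √(n₀ + 1))`, works on `W ∩ B(ŵ_k, R₀ / 2 ^ k)`, and consumes
the next `n₀` samples. -/
def asaIter (g : E → Z → E) (W : Set E) (G R₀ : ℝ) (n : ℕ) (w₁ : E) (z : ℕ → Z) : ℕ → E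
  | 0 => w₁
  | k + 1 =>
      ssg g (W ∩ Metric.closedBall (asaIter g W G R₀ n w₁ z k) (R₀ / 2 ^ k))
        (R₀ / 2 ^ k / (G * √((asaSteps n : ℝ) + 1))) (asaIter g W G R₀ n w₁ z k)
        (fun t => z (k * asaSteps n + t)) (asaSteps n)

/-- The output of ASA(w₁, n, R₀), which uses at most the first `n` samples. -/
def asa (g : E → Z → E) (W : Set E) (G R₀ : ℝ) (n : ℕ) (w₁ : E) (z : ℕ → Z) : E :=
  asaIter g W G R₀ n w₁ z (asaStages n)

/-- The law of a sequence `z₀, z₁, …` of independent samples from `μ`. -/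
def iidLaw (μ : Measure Z) [IsProbabilityMeasure μ] : Measure (ℕ → Z) :=
  Measure.infinitePi fun _ => μ

end FastRates

end

noncomputable section

namespace FastRates

/-! ### Polytopes, their vertices, and sharpness of linear programs. -/

section Polyhedra

variable {E : Type*} [NormedAddCommGroup E] [InnerProductSpace ℝ E]

/-! Sharpness is a fact about polytopes. A point of a polytope is a convex combination of finitely
many vertices. Moving the mass on the non-optimal vertices to one optimal point costs a distance
proportional to that mass, while each unit of it contributes a fixed gap to the objective
(`IsPolyhedron.exists_sharp`). For a piecewise linear risk, each piece either attains the global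
minimum, and is then such a linear program, or stays above it by a positive gap, and then
boundedness suffices. Multiplying by the diameter turns sharpness into EBC.

For ERM, each point `u` of a net of mesh `1 / n ^ 2` is compared with its nearest minimizer `v`. The
increment `f u z - f v z` has mean `D`, the excess risk, and size at most `G * ‖u - v‖`. Since `exp
(-x) ≤ 1 - x + x ^ 2` for `|x| ≤ 1`, a multiplier `l` whose second order term is at most half of `l
* D` makes it unlikely, up to `exp (-n * l * D / 2)`, that `u` looks empirically as good as `v`; a
union bound over the net follows (`iidLaw_erm_le`). Under EBC the second order term is of order `l ^
2 * D`, so `l` can be a constant, and `D` of order `d log n / n` is excluded. Under weak sharp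
minima the increment is bounded by a multiple of `D`, so `l` can be of order `1 / D` and the
exponent no longer depends on `D`. Once `n` exceeds a multiple of `d log n + log (1 / δ)`, only the
discretization error of order `1 / n ^ 2` remains; for smaller `n` the bound is trivial. The term
with `P_*` is non-negative and only weakens this estimate.

For ASA, one stage is projected subgradient regret plus a Chernoff bound for a martingale
(`iidLaw_ssg_le`), against a comparator that may depend on the past: the nearest minimizer if it is
within the current radius, else the centre itself. Outside the union of the bad stage events, what
remains is a deterministic recursion (`adaptive_stages_le`). While the minimizer stays in range the
excess risk shrinks with the radius; once it escapes, the excess risk is already of the target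
order, and the later radii form a geometric series that cannot spoil it. -/

theorem IsPolyhedron.isClosed {S : Set E} (hS : IsPolyhedron S) : IsClosed S := by
  obtain ⟨m, a, b, rfl⟩ := hS
  simp only [Set.ofPred_forall]
  exact isClosed_iInter fun i => isClosed_le (by fun_prop) continuous_const

theorem IsPolyhedron.convex {S : Set E} (hS : IsPolyhedron S) : Convex ℝ S := by
  obtain ⟨m, a, b, rfl⟩ := hS
  simp only [Set.ofPred_forall]
  exact convex_iInter fun i => convex_halfSpace_le (innerₗ E (a i)).isLinear (b i)

theorem IsPolyhedron.inter {S T : Set E} (hS : IsPolyhedron S) (hT : IsPolyhedron T) :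
    IsPolyhedron (S ∩ T) := by
  obtain ⟨m, a, b, rfl⟩ := hS
  obtain ⟨k, a', b', rfl⟩ := hT
  refine ⟨m + k, Fin.append a a', Fin.append b b', ?_⟩
  ext w
  simp only [Set.mem_inter_iff, Set.mem_ofPred_eq]
  constructor
  · rintro ⟨h1, h2⟩ i
    refine Fin.addCases (fun j => ?_) (fun j => ?_) i
    · simpa using h1 j
    · simpa using h2 j
  · intro h
    exact ⟨fun i => by simpa using h (Fin.castAdd k i), fun i => by simpa using h (Fin.natAdd m i)⟩

/-- An extreme point of a polyhedron is determined by its active constraints. -/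
theorem IsPolyhedron.finite_extremePoints {S : Set E} (hS : IsPolyhedron S) :
    (S.extremePoints ℝ).Finite := by
  classical
  obtain ⟨m, a, b, rfl⟩ := hS
  refine Set.Finite.of_injOn (t := Set.univ)
    (f := fun w : E => Finset.univ.filter fun i => inner ℝ (a i) w = b i)
    (fun _ _ => Set.mem_univ _) ?_ Set.finite_univ
  intro x hx y hy hxy
  by_contra hne
  have hact : ∀ i, inner ℝ (a i) x = b i ↔ inner ℝ (a i) y = b i := fun i => by
    simpa using Finset.ext_iff.1 hxy i
  have hxS : ∀ i, inner ℝ (a i) x ≤ b i := hx.1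
  have hyS : ∀ i, inner ℝ (a i) y ≤ b i := hy.1
  -- The direction `y - x` is orthogonal to every common active normal, and inactive constraints
  -- have slack, so `x` can be pushed away from `y` inside the polyhedron.
  have hev : ∀ᶠ t : ℝ in nhds 0, ∀ i, inner ℝ (a i) (x - t • (y - x)) ≤ b i := by
    rw [Filter.eventually_all]
    intro i
    by_cases hi : inner ℝ (a i) x = b i
    · refine Filter.Eventually.of_forall fun t => ?_
      rw [inner_sub_right, inner_smul_right, inner_sub_right, (hact i).1 hi, hi]
      simp
    · have hlt := lt_of_le_of_ne (hxS i) hi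
      have hc : Continuous fun t : ℝ => (inner ℝ (a i) (x - t • (y - x)) : ℝ) := by fun_prop
      have h0 : (inner ℝ (a i) (x - (0 : ℝ) • (y - x)) : ℝ) < b i := by simpa using hlt
      exact ((hc.tendsto 0).eventually (gt_mem_nhds h0)).mono fun t ht => le_of_lt ht
  obtain ⟨ε, hε, hball⟩ := Metric.eventually_nhds_iff.1 hev
  have hz := hball (y := ε / 2) (by simp [abs_of_pos hε, hε])
  have hseg : x ∈ openSegment ℝ (x - (ε / 2) • (y - x)) y := by
    refine ⟨1 / (1 + ε / 2), (ε / 2) / (1 + ε / 2), by positivity, by positivity, by field_simp, ?_⟩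
    have h1 : (1 + ε / 2) ≠ 0 := by positivity
    have : (1 / (1 + ε / 2)) • (x - (ε / 2) • (y - x)) + ((ε / 2) / (1 + ε / 2)) • y
        = ((1 + ε / 2) / (1 + ε / 2)) • x := by module
    rw [this, div_self h1, one_smul]
  have := hx.2 hz hy.1 hseg
  apply hne
  have h2 : (ε / 2) • (y - x) = 0 := by
    have h3 : x - (ε / 2) • (y - x) = x := by simpa using this
    simpa using h3
  rcases smul_eq_zero.1 h2 with h | h
  · linarith
  · exact (sub_eq_zero.1 h).symm

/-- Linear programs over polytopes have weak sharp minima. -/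
theorem IsPolyhedron.exists_sharp [FiniteDimensional ℝ E] {S : Set E} (hS : IsPolyhedron S)
    (hb : Bornology.IsBounded S) (a : E) {c : ℝ} (hc : ∀ w ∈ S, c ≤ inner ℝ a w)
    (hatt : ∃ w ∈ S, inner ℝ a w = c) :
    ∃ κ > 0, ∀ w ∈ S, ∃ v ∈ S, inner ℝ a v = c ∧ ‖w - v‖ ≤ κ * (inner ℝ a w - c) := by
  classical
  have hcomp : IsCompact S := Metric.isCompact_of_isClosed_isBounded hS.isClosed hb
  have hfin := hS.finite_extremePoints
  -- Krein–Milman; the closure disappears because the hull of a finite set is closed.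
  have hhull : convexHull ℝ (S.extremePoints ℝ) = S := by
    have := closure_convexHull_extremePoints hcomp hS.convex
    rwa [(hfin.isClosed_convexHull ℝ).closure_eq] at this
  obtain ⟨D, hD⟩ := hb.exists_norm_le
  obtain ⟨w₀, hw₀, hw₀c⟩ := hatt
  have hD0 : 0 ≤ D := (norm_nonneg _).trans (hD w₀ hw₀)
  -- the vertices outside the optimal face exceed the optimal value by at least `η`
  obtain ⟨η, hη, hgap⟩ : ∃ η > 0, ∀ v ∈ S.extremePoints ℝ, inner ℝ a v ≠ c →
      η ≤ inner ℝ a v - c := by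
    have : ∀ᶠ η : ℝ in nhdsWithin 0 (Set.Ioi 0), ∀ v ∈ S.extremePoints ℝ, inner ℝ a v ≠ c →
        η ≤ inner ℝ a v - c := by
      rw [Filter.eventually_all_finite hfin]
      intro v hv
      by_cases hvc : inner ℝ a v = c
      · exact Filter.Eventually.of_forall fun _ h => absurd hvc h
      · have : 0 < inner ℝ a v - c :=
          sub_pos.2 (lt_of_le_of_ne (hc v (extremePoints_subset hv)) (Ne.symm hvc))
        filter_upwards [nhdsWithin_le_nhds (Iio_mem_nhds this)] with t ht _ using le_of_lt ht
    obtain ⟨η, h1, h2⟩ := (this.and self_mem_nhdsWithin).exists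
    exact ⟨η, h2, h1⟩
  refine ⟨(2 * D + 1) / η, by positivity, fun w hw => ?_⟩
  have hwh : w ∈ convexHull ℝ (S.extremePoints ℝ) := by rwa [hhull]
  rw [← hfin.coe_toFinset, Finset.mem_convexHull'] at hwh
  obtain ⟨l, hl0, hl1, hlw⟩ := hwh
  set V := hfin.toFinset with hV
  have hVS : ∀ v ∈ V, v ∈ S := fun v hv => extremePoints_subset (hfin.mem_toFinset.1 hv)
  -- move the mass of the other vertices to `w₀`
  set p : E → E := fun v => if inner ℝ a v = c then v else w₀ with hp
  have hpS : ∀ v ∈ V, p v ∈ S := fun v hv => by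
    simp only [hp]; split_ifs
    exacts [hVS v hv, hw₀]
  have hpc : ∀ v, inner ℝ a (p v) = c := fun v => by
    simp only [hp]; split_ifs with h
    exacts [h, hw₀c]
  refine ⟨∑ v ∈ V, l v • p v, hS.convex.sum_mem hl0 hl1 hpS, ?_, ?_⟩
  · simp only [inner_sum, inner_smul_right, hpc]
    rw [← Finset.sum_mul, hl1, one_mul]
  · have hval : inner ℝ a w - c = ∑ v ∈ V, l v * (inner ℝ a v - c) := by
      simp only [mul_sub, Finset.sum_sub_distrib, ← Finset.sum_mul, hl1, one_mul]
      rw [← hlw]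
      simp only [inner_sum, inner_smul_right]
    rw [hval, ← hlw, ← Finset.sum_sub_distrib, Finset.mul_sum]
    refine norm_sum_le_of_le _ fun v hv => ?_
    rw [← smul_sub, norm_smul, Real.norm_of_nonneg (hl0 v hv), mul_left_comm]
    refine mul_le_mul_of_nonneg_left ?_ (hl0 v hv)
    by_cases hvc : inner ℝ a v = c
    · simp [hp, hvc]
    · have h1 : ‖v - p v‖ ≤ 2 * D := by
        refine (norm_sub_le _ _).trans ?_
        linarith [hD v (hVS v hv), hD _ (hpS v hv)]
      have h2 := hgap v (hfin.mem_toFinset.1 hv) hvc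
      rw [div_mul_eq_mul_div, le_div_iff₀ hη]
      nlinarith

end Polyhedra

/-! ### Existence and compactness of minimizers. -/

theorem minValue_eq {E : Type*} {h : E → ℝ} {W : Set E} {v : E} (hv : v ∈ argminOn h W) :
    minValue h W = h v :=
  IsLeast.csInf_eq ⟨⟨v, hv.1, rfl⟩, by rintro _ ⟨u, hu, rfl⟩; exact hv.2 u hu⟩

section Minimizers

variable {E : Type*} [NormedAddCommGroup E] {h : E → ℝ} {W : Set E}

theorem argminOn_nonempty (hW : IsCompact W) (hne : W.Nonempty) (hc : ContinuousOn h W) :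
    (argminOn h W).Nonempty := by
  obtain ⟨v, hv, hmin⟩ := hW.exists_isMinOn hne hc
  exact ⟨v, hv, fun u hu => hmin hu⟩

theorem isCompact_argminOn (hW : IsCompact W) (hc : ContinuousOn h W) :
    IsCompact (argminOn h W) := by
  rcases (argminOn h W).eq_empty_or_nonempty with he | ⟨v, hv⟩
  · rw [he]; exact isCompact_empty
  · have : argminOn h W = W ∩ h ⁻¹' Set.Iic (h v) := by
      ext w
      exact ⟨fun hw => ⟨hw.1, hw.2 v hv.1⟩, fun hw => ⟨hw.1, fun u hu => le_trans hw.2 (hv.2 u hu)⟩⟩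
    rw [this]
    exact hW.of_isClosed_subset (hc.preimage_isClosed_of_isClosed hW.isClosed isClosed_Iic)
      Set.inter_subset_left

theorem exists_isNearest {K : Set E} (hK : IsCompact K) (hne : K.Nonempty) (x : E) :
    ∃ y, IsNearest K x y := by
  obtain ⟨y, hy, hmin⟩ := hK.exists_isMinOn (f := fun u => ‖x - u‖) hne (by fun_prop)
  exact ⟨y, hy, fun u hu => hmin hu⟩

/-- One factor of the squared distance is bounded by the diameter, the other by sharpness. -/
theorem WeakSharpMinima.exists_ebc (hb : Bornology.IsBounded W) {κ : ℝ} (hκ : 0 < κ)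
    (hs : WeakSharpMinima h W κ) : ∃ α > 0, EBC h W 1 α := by
  obtain ⟨D, hD⟩ := hb.exists_norm_le
  refine ⟨(2 * |D| + 1) * κ, by positivity, fun w hw => ?_⟩
  obtain ⟨v, hv, hle⟩ := hs w hw
  refine ⟨v, hv, ?_⟩
  have h1 : ‖w - v‖ ≤ 2 * |D| + 1 := by
    refine (norm_sub_le _ _).trans ?_
    linarith [hD w hw, hD v hv.1.1, le_abs_self D]
  rw [Real.rpow_one, sq, mul_assoc]
  exact mul_le_mul h1 hle (norm_nonneg _) (by positivity)

end Minimizers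

/-! ### Weak sharp minima for piecewise linear functions. -/

section PiecewiseLinear

variable {E : Type*} [NormedAddCommGroup E] [InnerProductSpace ℝ E]

/-- The pieces form a finite closed cover, so continuity on each of them suffices; agreement on
overlaps is automatic. -/
theorem IsPiecewiseLinearOn.continuousOn {h : E → ℝ} {W : Set E} (hW : IsClosed W)
    (hh : IsPiecewiseLinearOn h W) : ContinuousOn h W := by
  obtain ⟨N, Q, hQ, hcov, haff⟩ := hh
  have : W = ⋃ j, W ∩ Q j := by rw [← Set.inter_iUnion, Set.inter_eq_left.2 hcov]
  rw [this]
  refine LocallyFinite.continuousOn_iUnion (locallyFinite_of_finite _)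
    (fun j => hW.inter (hQ j).isClosed) fun j => ?_
  obtain ⟨a, b, hab⟩ := haff j
  refine ContinuousOn.congr (f := fun w => inner ℝ a w + b) (by fun_prop) fun w hw => hab w hw

variable {h : E → ℝ} {W : Set E}

/-- Weak sharp minima of piecewise linear functions on polytopes. -/
theorem IsPiecewiseLinearOn.exists_weakSharpMinima [FiniteDimensional ℝ E]
    (hW : IsPolyhedron W) (hb : Bornology.IsBounded W) (hne : W.Nonempty)
    (hh : IsPiecewiseLinearOn h W) : ∃ κ > 0, WeakSharpMinima h W κ := by
  have hcomp : IsCompact W := Metric.isCompact_of_isClosed_isBounded hW.isClosed hb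
  have hcont := hh.continuousOn hW.isClosed
  obtain ⟨v₀, hv₀⟩ := argminOn_nonempty hcomp hne hcont
  have hAc := isCompact_argminOn hcomp hcont
  obtain ⟨N, Q, hQ, hcov, haff⟩ := hh
  obtain ⟨D, hD⟩ := hb.exists_norm_le
  have hD0 : 0 ≤ D := (norm_nonneg _).trans (hD v₀ hv₀.1)
  have hpiece : ∀ j, ∃ κ > 0, ∀ w ∈ W ∩ Q j, ∃ v ∈ argminOn h W, ‖w - v‖ ≤ κ * (h w - h v₀) := by
    intro j
    rcases (W ∩ Q j).eq_empty_or_nonempty with he | hnej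
    · exact ⟨1, one_pos, fun w hw => by simp [he] at hw⟩
    have hcj : IsCompact (W ∩ Q j) := hcomp.inter_right (hQ j).isClosed
    obtain ⟨u, hu, humin⟩ := argminOn_nonempty hcj hnej (hcont.mono Set.inter_subset_left)
    -- If the minimum over the piece is the global one, the minimizers found by the linear program
    -- are global minimizers. Otherwise the gap `h u - h v₀` bounds the excess below and any
    -- minimizer will do.
    rcases eq_or_lt_of_le (hv₀.2 u hu.1) with heq | hlt
    · obtain ⟨a, b, hab⟩ := haff j
      obtain ⟨κ, hκ, hsharp⟩ := (hW.inter (hQ j)).exists_sharp (hb.subset Set.inter_subset_left) a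
        (c := inner ℝ a u) (fun w hw => by
          have := humin w hw
          rw [hab w hw, hab u hu] at this
          linarith) ⟨u, hu, rfl⟩
      refine ⟨κ, hκ, fun w hw => ?_⟩
      obtain ⟨v, hv, hvu, hle⟩ := hsharp w hw
      refine ⟨v, ⟨hv.1, fun x hx => ?_⟩, ?_⟩
      · rw [hab v hv, hvu, ← hab u hu, ← heq]
        exact hv₀.2 x hx
      · rw [heq, hab w hw, hab u hu]
        simpa using hle
    · refine ⟨(2 * D + 1) / (h u - h v₀), div_pos (by positivity) (sub_pos.2 hlt),
        fun w hw => ⟨v₀, hv₀, ?_⟩⟩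
      have h1 : ‖w - v₀‖ ≤ 2 * D + 1 := by
        refine (norm_sub_le _ _).trans ?_
        linarith [hD w hw.1, hD v₀ hv₀.1]
      have h2 := humin w hw
      rw [div_mul_eq_mul_div, le_div_iff₀ (sub_pos.2 hlt)]
      exact mul_le_mul h1 (by linarith) (by linarith) (by positivity)
  choose κ hκ hsharp using hpiece
  have hκ0 : 0 ≤ ∑ j, κ j := Finset.sum_nonneg fun j _ => (hκ j).le
  refine ⟨∑ j, κ j + 1, by linarith, fun w hw => ?_⟩
  obtain ⟨j, hj⟩ := Set.mem_iUnion.1 (hcov hw)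
  obtain ⟨v, hv, hle⟩ := hsharp j w ⟨hw, hj⟩
  obtain ⟨y, hy⟩ := exists_isNearest hAc ⟨v₀, hv₀⟩ w
  refine ⟨y, hy, (hy.2 v hv).trans (hle.trans ?_)⟩
  rw [← minValue_eq hv₀, minValue_eq hy.1]
  refine mul_le_mul_of_nonneg_right ?_ (sub_nonneg.2 (hy.1.2 w hw))
  have := Finset.single_le_sum (f := κ) (fun j _ => (hκ j).le) (Finset.mem_univ j)
  linarith

end PiecewiseLinear

/-! ### Fresh samples and exponential tail bounds for i.i.d. sequences. -/

section IidLaw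

variable {Z : Type*} [MeasurableSpace Z] (μ : Measure Z) [IsProbabilityMeasure μ]

instance : IsProbabilityMeasure (iidLaw μ) := by unfold iidLaw; infer_instance

/-- Resampling one coordinate preserves the law of an i.i.d. sequence. -/
theorem measurePreserving_update (t : ℕ) :
    MeasurePreserving (fun p : (ℕ → Z) × Z => Function.update p.1 t p.2)
      ((iidLaw μ).prod μ) (iidLaw μ) := by
  have hm : Measurable fun p : (ℕ → Z) × Z => Function.update p.1 t p.2 := by
    refine measurable_pi_lambda _ fun i => ?_
    by_cases hi : i = t
    · subst hi; simpa using measurable_snd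
    · simpa [hi, Function.comp_def] using (measurable_pi_apply i).comp measurable_fst
  refine ⟨hm, ?_⟩
  refine Measure.eq_infinitePi (fun _ => μ) fun s A hA => ?_
  rw [Measure.map_apply hm (MeasurableSet.pi s.countable_toSet fun i _ => hA i)]
  have hpre : (fun p : (ℕ → Z) × Z => Function.update p.1 t p.2) ⁻¹' (Set.pi s A) =
      (Set.pi (s.erase t) A) ×ˢ (if t ∈ s then A t else Set.univ) := by
    ext ⟨z, x⟩
    simp only [Set.mem_preimage, Set.mem_pi, Set.mem_prod, Finset.mem_coe, Finset.mem_erase]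
    constructor
    · intro h
      refine ⟨fun i hi => by simpa [hi.1] using h i hi.2, ?_⟩
      split_ifs with ht
      · simpa using h t ht
      · trivial
    · rintro ⟨h1, h2⟩ i hi
      by_cases hit : i = t
      · subst hit; simpa [hi] using h2
      · simpa [hit] using h1 i ⟨hit, hi⟩
  rw [hpre, Measure.prod_prod, iidLaw, Measure.infinitePi_pi _ fun i _ => hA i]
  split_ifs with ht
  · exact Finset.prod_erase_mul s (fun i => μ (A i)) ht
  · rw [measure_univ, mul_one, Finset.erase_eq_of_notMem ht]

/-- Plays the role of conditioning on the other samples: not depending on coordinate `t` is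
expressed as invariance under `Function.update`, so no filtration is needed. -/
theorem lintegral_iidLaw_fresh (t : ℕ) {F : (ℕ → Z) × Z → ENNReal} (hF : Measurable F)
    (hdep : ∀ z x y, F (Function.update z t x, y) = F (z, y)) :
    ∫⁻ z, F (z, z t) ∂(iidLaw μ) = ∫⁻ z, ∫⁻ x, F (z, x) ∂μ ∂(iidLaw μ) := by
  have hG : Measurable fun z : ℕ → Z => F (z, z t) :=
    hF.comp (measurable_id.prodMk (measurable_pi_apply t))
  rw [← (measurePreserving_update μ t).lintegral_comp hG]
  simp only [Function.update_self, hdep]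
  exact lintegral_prod _ hF.aemeasurable

/-- The supermartingale argument: the last factor is integrated over its own sample, on which the
earlier factors do not depend, and contributes at most `a`. -/
theorem lintegral_prod_iidLaw_le (t₀ : ℕ) {ψ : ℕ → (ℕ → Z) × Z → ENNReal}
    (hψ : ∀ j, Measurable (ψ j))
    (hdep : ∀ j, ∀ i ≥ t₀ + j, ∀ z x y, ψ j (Function.update z i x, y) = ψ j (z, y))
    {a : ENNReal} (ha : ∀ j z, ∫⁻ x, ψ j (z, x) ∂μ ≤ a) (T : ℕ) :
    ∫⁻ z, ∏ j ∈ Finset.range T, ψ j (z, z (t₀ + j)) ∂(iidLaw μ) ≤ a ^ T := by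
  induction T with
  | zero => simp
  | succ T ih =>
    have hP : Measurable fun z : ℕ → Z => ∏ j ∈ Finset.range T, ψ j (z, z (t₀ + j)) :=
      Finset.measurable_prod _ fun j _ =>
        (hψ j).comp (measurable_id.prodMk (measurable_pi_apply _))
    have h := lintegral_iidLaw_fresh μ (t₀ + T)
      (F := fun p => (∏ j ∈ Finset.range T, ψ j (p.1, p.1 (t₀ + j))) * ψ T p)
      ((hP.comp measurable_fst).mul (hψ T)) (fun z x y => by
        simp only [hdep T _ le_rfl]
        congr 1
        refine Finset.prod_congr rfl fun j hj => ?_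
        have hlt := Finset.mem_range.1 hj
        rw [Function.update_of_ne (by omega), hdep j _ (by omega)])
    simp only [Finset.prod_range_succ]
    simp only at h
    rw [h, pow_succ]
    calc ∫⁻ z, ∫⁻ x, (∏ j ∈ Finset.range T, ψ j (z, z (t₀ + j))) * ψ T (z, x) ∂μ ∂(iidLaw μ)
        ≤ ∫⁻ z, (∏ j ∈ Finset.range T, ψ j (z, z (t₀ + j))) * a ∂(iidLaw μ) := by
          refine lintegral_mono fun z => ?_
          simp only
          rw [lintegral_const_mul (f := fun x => ψ T (z, x)) _
            ((hψ T).comp measurable_prodMk_left)]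
          gcongr
          exact ha T z
      _ = (∫⁻ z, ∏ j ∈ Finset.range T, ψ j (z, z (t₀ + j)) ∂(iidLaw μ)) * a :=
          lintegral_mul_const _ hP
      _ ≤ a ^ T * a := by gcongr

/-- Chernoff bound for sums of increments driven by fresh samples. -/
theorem iidLaw_sum_ge_le (t₀ : ℕ) {X : ℕ → (ℕ → Z) × Z → ℝ} (hX : ∀ j, Measurable (X j))
    (hdep : ∀ j, ∀ i ≥ t₀ + j, ∀ z x y, X j (Function.update z i x, y) = X j (z, y))
    {b : ℝ} (hb : ∀ j z, ∫⁻ x, ENNReal.ofReal (Real.exp (X j (z, x))) ∂μ ≤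
      ENNReal.ofReal (Real.exp b)) (T : ℕ) (s : ℝ) :
    iidLaw μ {z | s ≤ ∑ j ∈ Finset.range T, X j (z, z (t₀ + j))} ≤
      ENNReal.ofReal (Real.exp (T * b - s)) := by
  have hm : ∀ j, Measurable fun p => ENNReal.ofReal (Real.exp (X j p)) := fun j =>
    (Real.measurable_exp.comp (hX j)).ennreal_ofReal
  have h := lintegral_prod_iidLaw_le μ t₀ hm
    (fun j i hi z x y => by simp only [hdep j i hi z x y]) hb T
  have hprod : ∀ z : ℕ → Z, ∏ j ∈ Finset.range T, ENNReal.ofReal (Real.exp (X j (z, z (t₀ + j)))) =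
      ENNReal.ofReal (Real.exp (∑ j ∈ Finset.range T, X j (z, z (t₀ + j)))) := fun z => by
    rw [Real.exp_sum, ENNReal.ofReal_prod_of_nonneg fun _ _ => (Real.exp_pos _).le]
  simp only [hprod] at h
  have hsum : Measurable fun z : ℕ → Z => ∑ j ∈ Finset.range T, X j (z, z (t₀ + j)) :=
    Finset.measurable_sum _ fun j _ =>
      (hX j).comp (measurable_id.prodMk (measurable_pi_apply _))
  have hmark := mul_meas_ge_le_lintegral (μ := iidLaw μ)
    (Real.measurable_exp.comp hsum).ennreal_ofReal (ENNReal.ofReal (Real.exp s))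
  have hset : {z : ℕ → Z | s ≤ ∑ j ∈ Finset.range T, X j (z, z (t₀ + j))} ⊆
      {z | ENNReal.ofReal (Real.exp s) ≤ ENNReal.ofReal
        ((Real.exp ∘ fun z : ℕ → Z => ∑ j ∈ Finset.range T, X j (z, z (t₀ + j))) z)} :=
    fun z hz => ENNReal.ofReal_le_ofReal (Real.exp_le_exp.2 hz)
  refine (measure_mono hset).trans ?_
  rw [Real.exp_sub, ENNReal.ofReal_div_of_pos (Real.exp_pos s), Real.exp_nat_mul,
    ENNReal.ofReal_pow (Real.exp_pos b).le]
  rw [ENNReal.le_div_iff_mul_le (Or.inl (by simp [Real.exp_pos])) (Or.inl ENNReal.ofReal_ne_top),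
    mul_comm]
  exact hmark.trans h

theorem ae_iidLaw_forall {p : Z → Prop} (hp : ∀ᵐ x ∂μ, p x) :
    ∀ᵐ z ∂(iidLaw μ), ∀ i, p (z i) :=
  ae_all_iff.2 fun i =>
    (measurePreserving_eval_infinitePi (fun _ : ℕ => μ) i).quasiMeasurePreserving.ae hp

/-- Losses are only a.e. measurable. A measurable modification agrees with `X` at every sample of
almost every sequence, so the Chernoff bound carries over. -/
theorem iidLaw_sum_apply_ge_le {X : Z → ℝ} (hX : AEMeasurable X μ) {b : ℝ}
    (hb : ∫⁻ x, ENNReal.ofReal (Real.exp (X x)) ∂μ ≤ ENNReal.ofReal (Real.exp b)) (T : ℕ) (s : ℝ) :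
    iidLaw μ {z | s ≤ ∑ j ∈ Finset.range T, X (z j)} ≤
      ENNReal.ofReal (Real.exp (T * b - s)) := by
  have h := iidLaw_sum_ge_le μ 0 (X := fun _ p => hX.mk X p.2)
    (fun _ => hX.measurable_mk.comp measurable_snd) (fun _ _ _ _ _ _ => rfl) (b := b)
    (fun _ _ => by
      refine le_of_eq_of_le (lintegral_congr_ae ?_) hb
      filter_upwards [hX.ae_eq_mk] with x hx using by rw [hx]) T s
  refine le_of_eq_of_le (measure_congr (Filter.eventuallyEq_set.2 ?_)) h
  filter_upwards [ae_iidLaw_forall μ hX.ae_eq_mk] with z hz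
  simp [hz]

end IidLaw

/-! ### A second order exponential moment bound. -/

section Exponential

/-- The second order bound on the exponential moment behind Bernstein's inequality. -/
theorem lintegral_exp_neg_le {Z : Type*} [MeasurableSpace Z] {μ : Measure Z}
    [IsProbabilityMeasure μ] {X : Z → ℝ} (hX : Integrable X μ) {c : ℝ} (hc1 : c ≤ 1)
    (hc : ∀ x, |X x| ≤ c) :
    ∫⁻ x, ENNReal.ofReal (Real.exp (-X x)) ∂μ ≤
      ENNReal.ofReal (Real.exp (-∫ x, X x ∂μ + c ^ 2)) := by
  have hpt : ∀ x, Real.exp (-X x) ≤ 1 - X x + c ^ 2 := fun x => by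
    have h1 : |-X x| ≤ 1 := by rw [abs_neg]; exact (hc x).trans hc1
    have h2 := Real.abs_exp_sub_one_sub_id_le h1
    have h3 := (abs_le.1 h2).2
    have h4 : (-X x) ^ 2 ≤ c ^ 2 := by
      rw [neg_sq, ← sq_abs]
      exact pow_le_pow_left₀ (abs_nonneg _) (hc x) 2
    linarith
  have hint : Integrable (fun x => 1 - X x + c ^ 2) μ :=
    ((integrable_const 1).sub hX).add (integrable_const _)
  calc ∫⁻ x, ENNReal.ofReal (Real.exp (-X x)) ∂μ
      ≤ ∫⁻ x, ENNReal.ofReal (1 - X x + c ^ 2) ∂μ :=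
        lintegral_mono fun x => ENNReal.ofReal_le_ofReal (hpt x)
    _ = ENNReal.ofReal (∫ x, (1 - X x + c ^ 2) ∂μ) :=
        (ofReal_integral_eq_lintegral_ofReal hint
          (Filter.Eventually.of_forall fun x => (Real.exp_pos _).le.trans (hpt x))).symm
    _ ≤ ENNReal.ofReal (Real.exp (-∫ x, X x ∂μ + c ^ 2)) := by
        refine ENNReal.ofReal_le_ofReal ?_
        rw [integral_add (f := fun x => 1 - X x) ((integrable_const 1).sub hX)
          (integrable_const _), integral_sub (integrable_const 1) hX]
        simp only [integral_const, probReal_univ, one_smul]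
        linarith [Real.add_one_le_exp (-∫ x, X x ∂μ + c ^ 2)]

end Exponential

/-! ### Finite nets and metric entropy. -/

section Net

/-- A grid yields a finite net in a bounded subset of Euclidean space. -/
theorem exists_grid_net {d : ℕ} {W : Set (EuclideanSpace ℝ (Fin d))} {R : ℝ}
    (hne : W.Nonempty) (hR : ∀ w ∈ W, ‖w‖ ≤ R) {M : ℕ} (hM : 0 < M) :
    ∃ A : Finset (EuclideanSpace ℝ (Fin d)), ↑A ⊆ W ∧ (A.card : ℝ) ≤ (2 * (R * M) + 2) ^ d ∧
      ∀ w ∈ W, ∃ u ∈ A, ‖w - u‖ ≤ √d / M := by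
  classical
  have hM' : (0 : ℝ) < M := by exact_mod_cast hM
  obtain ⟨w₀, hw₀⟩ := hne
  -- `c w` is the grid cell of side `1 / M` containing `w`. Choosing one representative in `W` for
  -- each occupied cell keeps the net inside `W`.
  set c : EuclideanSpace ℝ (Fin d) → Fin d → ℤ := fun w i => ⌊w i * M⌋ with hc
  set B : Finset (Fin d → ℤ) := Fintype.piFinset fun _ => Finset.Icc ⌊-(R * M)⌋ ⌊R * M⌋ with hB
  have hcB : c '' W ⊆ B := by
    rintro _ ⟨w, hw, rfl⟩
    simp only [hB, Finset.mem_coe, Fintype.mem_piFinset, Finset.mem_Icc, hc]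
    intro i
    have h1 : |w i| ≤ R := (PiLp.norm_apply_le w i).trans (hR w hw)
    have h2 := abs_le.1 h1
    exact ⟨Int.floor_mono (by nlinarith), Int.floor_mono (by nlinarith)⟩
  have hfin : (c '' W).Finite := B.finite_toSet.subset hcB
  have hrep : ∀ k ∈ c '' W, ∃ w, w ∈ W ∧ c w = k := fun k hk => hk
  choose! r hrW hrc using hrep
  refine ⟨hfin.toFinset.image r, ?_, ?_, ?_⟩
  · intro u hu
    simp only [Finset.coe_image, Set.Finite.coe_toFinset, Set.mem_image] at hu
    obtain ⟨k, hk, rfl⟩ := hu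
    exact hrW k hk
  · have h1 : (hfin.toFinset.image r).card ≤ B.card :=
      Finset.card_image_le.trans (Finset.card_le_card fun k hk => by
        simpa using hcB (by simpa using hk))
    have h2 : B.card = (⌊R * M⌋ + 1 - ⌊-(R * M)⌋).toNat ^ d := by
      simp [hB, Fintype.card_piFinset]
    have hR0 : 0 ≤ R := (norm_nonneg _).trans (hR w₀ hw₀)
    have h3 : (((⌊R * M⌋ + 1 - ⌊-(R * M)⌋).toNat : ℤ) : ℝ) ≤ 2 * (R * M) + 2 := by
      rw [Int.toNat_of_nonneg]
      · push_cast
        linarith [Int.floor_le (R * M), Int.lt_floor_add_one (-(R * M))]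
      · have : ⌊-(R * M)⌋ ≤ ⌊R * M⌋ := Int.floor_mono (by nlinarith [mul_nonneg hR0 hM'.le])
        omega
    calc ((hfin.toFinset.image r).card : ℝ) ≤ B.card := by exact_mod_cast h1
      _ = ((⌊R * M⌋ + 1 - ⌊-(R * M)⌋).toNat : ℝ) ^ d := by rw [h2]; push_cast; rfl
      _ ≤ _ := pow_le_pow_left₀ (Nat.cast_nonneg _) (by exact_mod_cast h3) d
  · intro w hw
    have hk : c w ∈ c '' W := ⟨w, hw, rfl⟩
    refine ⟨r (c w), Finset.mem_image_of_mem r (by simpa using hk), ?_⟩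
    have hcoord : ∀ i, ‖(w - r (c w)) i‖ ^ 2 ≤ (1 / M : ℝ) ^ 2 := fun i => by
      have h1 : ⌊w i * M⌋ = ⌊r (c w) i * M⌋ := (congrFun (hrc _ hk) i).symm
      have h2 := Int.abs_sub_lt_one_of_floor_eq_floor h1
      rw [← sub_mul, abs_mul, abs_of_pos hM'] at h2
      refine pow_le_pow_left₀ (norm_nonneg _) ?_ 2
      rw [le_div_iff₀ hM']
      exact h2.le
    rw [EuclideanSpace.norm_eq, Real.sqrt_le_iff]
    refine ⟨by positivity, (Finset.sum_le_sum fun i _ => hcoord i).trans_eq ?_⟩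
    rw [div_pow (√(d : ℝ)), Real.sq_sqrt (Nat.cast_nonneg d)]
    simp [div_eq_mul_inv]

/-- The constant in the metric entropy bound `exists_fine_net`. -/
def entropyConst (R : ℝ) : ℝ := 3 + Real.log (2 * |R| + 2) / Real.log 2

theorem one_le_entropyConst (R : ℝ) : 1 ≤ entropyConst R := by
  have h1 : 0 ≤ Real.log (2 * |R| + 2) := Real.log_nonneg (by linarith [abs_nonneg R])
  have h2 : 0 ≤ Real.log 2 := Real.log_nonneg one_le_two
  have := div_nonneg h1 h2
  unfold entropyConst
  linarith

theorem exists_fine_net {d : ℕ} {W : Set (EuclideanSpace ℝ (Fin d))} {R : ℝ}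
    (hne : W.Nonempty) (hR : ∀ w ∈ W, ‖w‖ ≤ R) {n : ℕ} (hn : 2 ≤ n) (hdn : d ≤ n) :
    ∃ A : Finset (EuclideanSpace ℝ (Fin d)), ↑A ⊆ W ∧ A.Nonempty ∧
      Real.log A.card ≤ entropyConst R * (d * Real.log n) ∧
      ∀ w ∈ W, ∃ u ∈ A, ‖w - u‖ ≤ 1 / (n : ℝ) ^ 2 := by
  -- With `d ≤ n` the mesh `√d / n ^ 3` is at most `1 / n ^ 2`, and the cubic resolution costs only
  -- the summand 3 in `entropyConst`.
  obtain ⟨A, hAW, hcard, hnet⟩ := exists_grid_net hne hR (M := n ^ 3) (by positivity)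
  obtain ⟨w₀, hw₀⟩ := hne
  have hR0 : 0 ≤ R := (norm_nonneg _).trans (hR w₀ hw₀)
  have hn2 : (2 : ℝ) ≤ n := by exact_mod_cast hn
  have hn3 : (1 : ℝ) ≤ (n : ℝ) ^ 3 := one_le_pow₀ (by linarith)
  have hA : A.Nonempty := by
    obtain ⟨u, hu, -⟩ := hnet w₀ hw₀
    exact ⟨u, hu⟩
  refine ⟨A, hAW, hA, ?_, fun w hw => ?_⟩
  · have hA0 : (0 : ℝ) < A.card := by exact_mod_cast hA.card_pos
    have h2 : 0 < Real.log 2 := Real.log_pos one_lt_two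
    have hlogn : Real.log 2 ≤ Real.log n := Real.log_le_log two_pos hn2
    have h3 : 0 ≤ Real.log (2 * R + 2) := Real.log_nonneg (by linarith)
    calc Real.log A.card ≤ Real.log ((2 * (R * (n ^ 3 : ℕ)) + 2) ^ d) := Real.log_le_log hA0 hcard
      _ = d * Real.log (2 * (R * (n ^ 3 : ℕ)) + 2) := Real.log_pow _ _
      _ ≤ d * Real.log ((2 * R + 2) * n ^ 3) := by
          have : (0 : ℝ) < 2 * (R * (n ^ 3 : ℕ)) + 2 := by positivity
          gcongr
          push_cast
          nlinarith
      _ = d * (Real.log (2 * R + 2) + 3 * Real.log n) := by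
          rw [Real.log_mul (by positivity) (by positivity), Real.log_pow]
          norm_num
      _ ≤ d * (entropyConst R * Real.log n) := by
          gcongr
          rw [entropyConst, abs_of_nonneg hR0, add_mul, add_comm]
          gcongr
          rw [div_mul_eq_mul_div, le_div_iff₀ h2]
          gcongr
      _ = _ := by ring
  · obtain ⟨u, hu, hle⟩ := hnet w hw
    refine ⟨u, hu, hle.trans ?_⟩
    have hd : √(d : ℝ) ≤ n := by
      rw [Real.sqrt_le_left (by linarith)]
      have : (d : ℝ) ≤ n := by exact_mod_cast hdn
      nlinarith
    push_cast
    rw [div_le_div_iff₀ (by positivity) (by positivity)]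
    nlinarith [sq_nonneg (n : ℝ)]

end Net

/-! ### Union bound and exponential moments for empirical risk minimizers. -/

section EmpiricalRisk

variable {E : Type*} [NormedAddCommGroup E] {Z : Type*} [MeasurableSpace Z] {μ : Measure Z}
  [IsProbabilityMeasure μ] {f : E → Z → ℝ} {W : Set E} {G : ℝ}

theorem risk_sub_le (hf : ∀ w ∈ W, Integrable (f w) μ) (hG : IsLipschitzLoss f W G) {w u : E}
    (hw : w ∈ W) (hu : u ∈ W) : risk μ f w - risk μ f u ≤ G * ‖w - u‖ := by
  unfold risk
  rw [← integral_sub (hf w hw) (hf u hu)]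
  calc ∫ z, (f w z - f u z) ∂μ ≤ ∫ _, G * ‖w - u‖ ∂μ :=
        integral_mono ((hf w hw).sub (hf u hu)) (integrable_const _) fun z =>
          (le_abs_self _).trans (hG z w hw u hu)
    _ = G * ‖w - u‖ := by simp

theorem lintegral_exp_loss_sub_le (hf : ∀ w ∈ W, Integrable (f w) μ)
    (hG : IsLipschitzLoss f W G) {u v : E} (hu : u ∈ W) (hv : v ∈ W) {l c : ℝ} (hl : 0 ≤ l)
    (hlc : l * (G * ‖u - v‖) ≤ c) (hc1 : c ≤ 1) :
    ∫⁻ z, ENNReal.ofReal (Real.exp (-(l * (f u z - f v z)))) ∂μ ≤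
      ENNReal.ofReal (Real.exp (-(l * (risk μ f u - risk μ f v)) + c ^ 2)) := by
  have hint : Integrable (fun z => l * (f u z - f v z)) μ :=
    ((hf u hu).sub (hf v hv)).const_mul l
  refine (lintegral_exp_neg_le hint hc1 fun z => ?_).trans_eq ?_
  · rw [abs_mul, abs_of_nonneg hl]
    exact (mul_le_mul_of_nonneg_left (hG z u hu v hv) hl).trans hlc
  · unfold risk
    rw [integral_const_mul, integral_sub (hf u hu) (hf v hv)]

/-- A union bound for empirical risk minimizers over a net `A`. -/
theorem iidLaw_erm_le (hf : ∀ w ∈ W, Integrable (f w) μ) (hG0 : 0 ≤ G)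
    (hG : IsLipschitzLoss f W G) {A : Finset E} (hAW : ↑A ⊆ W) (hA : A.Nonempty) {ε : ℝ}
    (hnet : ∀ w ∈ W, ∃ u ∈ A, ‖w - u‖ ≤ ε) {n : ℕ} (hn : 0 < n) {δ : ℝ} (hδ : 0 < δ)
    {p τ : ℝ} (hexp : ∀ u ∈ A, τ < risk μ f u - p → ∃ v ∈ W, ∃ l ≥ 0, ∃ b : ℝ,
      ∫⁻ z, ENNReal.ofReal (Real.exp (-(l * (f u z - f v z)))) ∂μ ≤ ENNReal.ofReal (Real.exp b) ∧
      n * b + l * (n * (G * ε)) ≤ Real.log (δ / A.card)) :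
    iidLaw μ {z | ∃ w ∈ argminOn (empRisk f n z) W, τ + G * ε < risk μ f w - p} ≤
      ENNReal.ofReal δ := by
  classical
  have hA0 : (0 : ℝ) < A.card := by exact_mod_cast hA.card_pos
  have hn0 : (0 : ℝ) < n := by exact_mod_cast hn
  choose! v hvW l hl b hb hbl using hexp
  set A' := A.filter fun u => τ < risk μ f u - p with hA'
  have hmem : ∀ u ∈ A', u ∈ A ∧ τ < risk μ f u - p := fun u hu => Finset.mem_filter.1 hu
  -- A bad minimizer `w` has a net point `u` within `ε`: its excess risk still exceeds `τ`, and its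
  -- empirical risk exceeds that of any point of `W`, in particular `v u`, by at most `G * ε`.
  have hsub : {z | ∃ w ∈ argminOn (empRisk f n z) W, τ + G * ε < risk μ f w - p} ⊆
      ⋃ u ∈ A', {z | -(l u * (n * (G * ε))) ≤
        ∑ j ∈ Finset.range n, -(l u * (f u (z j) - f (v u) (z j)))} := by
    rintro z ⟨w, hw, hlt⟩
    obtain ⟨u, hu, hwu⟩ := hnet w hw.1
    have h1 := risk_sub_le hf hG hw.1 (hAW hu)
    have h2 : G * ‖w - u‖ ≤ G * ε := mul_le_mul_of_nonneg_left hwu hG0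
    have hτ : τ < risk μ f u - p := by linarith
    refine Set.mem_biUnion (x := u) (Finset.mem_filter.2 ⟨hu, hτ⟩) ?_
    have hmin := hw.2 (v u) (hvW u hu hτ)
    unfold empRisk at hmin
    rw [mul_le_mul_iff_right₀ (by positivity)] at hmin
    have h3 : ∑ j ∈ Finset.range n, f u (z j) ≤ ∑ j ∈ Finset.range n, (f w (z j) + G * ε) :=
      Finset.sum_le_sum fun j _ => by
        have := (abs_le.1 (hG (z j) w hw.1 u (hAW hu))).1
        linarith
    rw [Finset.sum_add_distrib] at h3
    simp only [Finset.sum_const, Finset.card_range, nsmul_eq_mul] at h3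
    show -(l u * (n * (G * ε))) ≤ ∑ j ∈ Finset.range n, -(l u * (f u (z j) - f (v u) (z j)))
    rw [Finset.sum_neg_distrib, ← Finset.mul_sum, Finset.sum_sub_distrib, neg_le_neg_iff]
    exact mul_le_mul_of_nonneg_left (by linarith) (hl u hu hτ)
  calc iidLaw μ {z | ∃ w ∈ argminOn (empRisk f n z) W, τ + G * ε < risk μ f w - p}
      ≤ ∑ u ∈ A', iidLaw μ {z | -(l u * (n * (G * ε))) ≤
        ∑ j ∈ Finset.range n, -(l u * (f u (z j) - f (v u) (z j)))} :=
        (measure_mono hsub).trans (measure_biUnion_finset_le _ _)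
    _ ≤ ∑ _u ∈ A', ENNReal.ofReal (δ / A.card) := by
        refine Finset.sum_le_sum fun u hu => ?_
        obtain ⟨huA, hτ⟩ := hmem u hu
        refine (iidLaw_sum_apply_ge_le μ (X := fun z => -(l u * (f u z - f (v u) z)))
          (((hf u (hAW huA)).aemeasurable.sub (hf _ (hvW u huA hτ)).aemeasurable).const_mul _).neg
          (hb u huA hτ) n _).trans (ENNReal.ofReal_le_ofReal ?_)
        rw [sub_neg_eq_add, ← Real.le_log_iff_exp_le (by positivity)]
        exact hbl u huA hτ
    _ = ENNReal.ofReal (A'.card * (δ / A.card)) := by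
        rw [Finset.sum_const, nsmul_eq_mul, ENNReal.ofReal_mul (Nat.cast_nonneg _),
          ENNReal.ofReal_natCast]
    _ ≤ ENNReal.ofReal δ := by
        refine ENNReal.ofReal_le_ofReal ?_
        have : (A'.card : ℝ) ≤ A.card := by exact_mod_cast Finset.card_filter_le _ _
        rw [mul_div_assoc', div_le_iff₀ hA0, mul_comm]
        gcongr

/-- The exponential moment for an excess risk controlled by the squared distance. -/
theorem lintegral_exp_loss_sub_le_of_sq (hf : ∀ w ∈ W, Integrable (f w) μ) (hG0 : 0 < G)
    (hG : IsLipschitzLoss f W G) {u v : E} (hu : u ∈ W) (hv : v ∈ W) {α B : ℝ} (hα : 0 < α)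
    (hB : ‖u - v‖ ≤ B) (hα' : ‖u - v‖ ^ 2 ≤ α * (risk μ f u - risk μ f v)) {l : ℝ}
    (hl : l = 1 / (2 * G ^ 2 * α + G * B)) :
    ∫⁻ z, ENNReal.ofReal (Real.exp (-(l * (f u z - f v z)))) ∂μ ≤
      ENNReal.ofReal (Real.exp (-(l * (risk μ f u - risk μ f v)) / 2)) := by
  have hB0 : 0 ≤ B := (norm_nonneg _).trans hB
  have hden : 0 < 2 * G ^ 2 * α + G * B := by positivity
  have hl0 : 0 < l := by rw [hl]; positivity
  refine (lintegral_exp_loss_sub_le hf hG hu hv hl0.le le_rfl ?_).trans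
    (ENNReal.ofReal_le_ofReal (Real.exp_le_exp.2 ?_))
  · rw [hl, div_mul_eq_mul_div, div_le_one hden]
    have : G * ‖u - v‖ ≤ G * B := by gcongr
    have : 0 < 2 * G ^ 2 * α := by positivity
    linarith
  · have h1 : l * (2 * G ^ 2 * α) ≤ 1 := by
      rw [hl, div_mul_eq_mul_div, div_le_one hden]
      have : 0 ≤ G * B := by positivity
      linarith
    have hD : 0 ≤ risk μ f u - risk μ f v :=
      (mul_nonneg_iff_of_pos_left hα).1 ((sq_nonneg _).trans hα')
    -- The summand `2 * G ^ 2 * α` in the denominator of `l` absorbs the second order term into half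
    -- of the mean; the summand `G * B` keeps the exponent in `[-1, 1]`.
    have h2 : (l * (G * ‖u - v‖)) ^ 2 ≤ l * (risk μ f u - risk μ f v) / 2 := by
      calc (l * (G * ‖u - v‖)) ^ 2 = l ^ 2 * G ^ 2 * ‖u - v‖ ^ 2 := by ring
        _ ≤ l ^ 2 * G ^ 2 * (α * (risk μ f u - risk μ f v)) := by gcongr
        _ = (l * (2 * G ^ 2 * α)) * (l * (risk μ f u - risk μ f v) / 2) := by ring
        _ ≤ 1 * (l * (risk μ f u - risk μ f v) / 2) := by gcongr
        _ = _ := one_mul _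
    linarith

/-- The exponential moment for an excess risk controlled by the distance. -/
theorem lintegral_exp_loss_sub_le_of_sharp (hf : ∀ w ∈ W, Integrable (f w) μ) (hG0 : 0 < G)
    (hG : IsLipschitzLoss f W G) {u v : E} (hu : u ∈ W) (hv : v ∈ W) {κ : ℝ} (hκ : 0 < κ)
    (hD : 0 < risk μ f u - risk μ f v) (hκ' : ‖u - v‖ ≤ κ * (risk μ f u - risk μ f v)) {l : ℝ}
    (hl : l = 1 / (2 * G ^ 2 * κ ^ 2 * (risk μ f u - risk μ f v))) :
    ∫⁻ z, ENNReal.ofReal (Real.exp (-(l * (f u z - f v z)))) ∂μ ≤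
      ENNReal.ofReal (Real.exp (-(l * (risk μ f u - risk μ f v)) / 2)) := by
  have hrisk := risk_sub_le hf hG hu hv
  set D := risk μ f u - risk μ f v with hDdef
  have hl0 : 0 < l := by rw [hl]; positivity
  -- Lipschitz continuity and sharpness bound `D` from both sides, which forces this. Hence `c = 1 /
  -- (2 * (G * κ))` is admissible, and `l * D = 2 * c ^ 2` makes the second order term exactly half
  -- of the mean.
  have hGκ : 1 ≤ G * κ := by
    have h1 : D ≤ G * (κ * D) := hrisk.trans (by gcongr)
    have h2 : 1 * D ≤ (G * κ) * D := by linarith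
    exact le_of_mul_le_mul_right h2 hD
  refine (lintegral_exp_loss_sub_le hf hG hu hv hl0.le (c := 1 / (2 * (G * κ))) ?_ ?_).trans
    (ENNReal.ofReal_le_ofReal (Real.exp_le_exp.2 (le_of_eq ?_)))
  · calc l * (G * ‖u - v‖) ≤ l * (G * (κ * D)) := by gcongr
      _ = 1 / (2 * (G * κ)) := by rw [hl]; field_simp
  · rw [div_le_one (by positivity)]
    linarith
  · rw [← hDdef, hl]
    field_simp
    ring

end EmpiricalRisk

/-! ### The two rates for empirical risk minimization. -/

section Rates

variable {d : ℕ} {W : Set (EuclideanSpace ℝ (Fin d))} {Z : Type*} [MeasurableSpace Z]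
  {μ : Measure Z} [IsProbabilityMeasure μ] {f : EuclideanSpace ℝ (Fin d) → Z → ℝ} {G : ℝ}

theorem sub_minValue_eq_zero_of_subsingleton {E : Type*} [Subsingleton E] {h : E → ℝ} {W : Set E}
    {v : E} (hv : v ∈ argminOn h W) (w : E) : h w - minValue h W = 0 := by
  rw [minValue_eq hv, Subsingleton.elim w v, sub_self]

theorem iidLaw_eq_zero_of_imp_false {p : (ℕ → Z) → Prop} (hp : ∀ z, ¬ p z) :
    iidLaw μ {z | p z} = 0 := by
  have : {z | p z} = ∅ := Set.eq_empty_iff_forall_notMem.2 hp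
  rw [this, measure_empty]

theorem risk_sub_minValue_le (hf : ∀ w ∈ W, Integrable (f w) μ) (hG0 : 0 < G)
    (hG : IsLipschitzLoss f W G) {v : EuclideanSpace ℝ (Fin d)}
    (hv : v ∈ argminOn (risk μ f) W) {R : ℝ} (hR : ∀ w ∈ W, ‖w‖ ≤ R)
    {w : EuclideanSpace ℝ (Fin d)} (hw : w ∈ W) :
    risk μ f w - minValue (risk μ f) W ≤ 2 * (R * G) := by
  rw [minValue_eq hv]
  have h1 := risk_sub_le hf hG hw hv.1
  have h2 : ‖w - v‖ ≤ 2 * R := (norm_sub_le _ _).trans (by linarith [hR w hw, hR v hv.1])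
  nlinarith

theorem half_le_log_of_two_le {n : ℕ} (hn : 2 ≤ n) : 1 / 2 ≤ Real.log n := by
  have h1 : Real.log 2 ≤ Real.log n := Real.log_le_log two_pos (by exact_mod_cast hn)
  linarith [Real.log_two_gt_d9]

/-- The constant in the fast rate of empirical risk minimization. -/
def ermConst (α G R : ℝ) : ℝ :=
  6 * G + 2 * entropyConst R * (2 * G ^ 2 * α + G * (2 * R)) + 4 * (R * G)

/-- Empirical risk minimization has the rate `d log n / n` under the error bound condition with
exponent one. -/
theorem iidLaw_erm_ebc_le (hf : ∀ w ∈ W, Integrable (f w) μ) (hG0 : 0 < G)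
    (hG : IsLipschitzLoss f W G) (hmin : (argminOn (risk μ f) W).Nonempty) {α : ℝ} (hα : 0 < α)
    (hebc : EBC (risk μ f) W 1 α) {R : ℝ} (hR : ∀ w ∈ W, ‖w‖ ≤ R) {n : ℕ} (hn : 2 ≤ n) {δ : ℝ}
    (hδ : 0 < δ) (hδ1 : δ < 1) :
    iidLaw μ {z | ∃ w ∈ argminOn (empRisk f n z) W,
      ermConst α G R * ((d * Real.log n + Real.log (1 / δ)) / n) <
        risk μ f w - minValue (risk μ f) W} ≤ ENNReal.ofReal δ := by
  obtain ⟨v₀, hv₀⟩ := hmin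
  have hR0 : 0 ≤ R := (norm_nonneg _).trans (hR v₀ hv₀.1)
  have hn0 : (0 : ℝ) < n := by positivity
  have hlogn := half_le_log_of_two_le hn
  have hlogδ : 0 < Real.log (1 / δ) := Real.log_pos (by rw [lt_div_iff₀ hδ]; linarith)
  set K := entropyConst R with hK
  have hK1 : 1 ≤ K := one_le_entropyConst R
  set L : ℝ := d * Real.log n + Real.log (1 / δ) with hL
  have hL0 : 0 < L := by positivity
  set B : ℝ := 2 * G ^ 2 * α + G * (2 * R) with hB
  have hB0 : 0 < B := by positivity
  have hC0 : 0 ≤ ermConst α G R := by unfold ermConst; positivity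
  -- For `d = 0` the lower bound `1 / 2 ≤ L` may fail, since `log (1 / δ)` can be arbitrarily small,
  -- but then the space is a single point.
  rcases Nat.eq_zero_or_pos d with hd | hd
  · refine le_of_eq_of_le (iidLaw_eq_zero_of_imp_false ?_) zero_le
    rintro z ⟨w, -, hlt⟩
    have : Subsingleton (EuclideanSpace ℝ (Fin d)) := by subst hd; infer_instance
    rw [sub_minValue_eq_zero_of_subsingleton hv₀] at hlt
    exact absurd hlt (not_lt.2 (by positivity))
  have hd1 : (1 : ℝ) ≤ d := by exact_mod_cast hd
  have hL1 : 1 / 2 ≤ L := by nlinarith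
  -- The net requires `d ≤ n`. If `d` is larger, the trivial bound `2 * (R * G)` on the excess risk
  -- is covered by the last term of `ermConst`.
  rcases lt_or_ge n d with hdn | hdn
  · refine le_of_eq_of_le (iidLaw_eq_zero_of_imp_false ?_) zero_le
    rintro z ⟨w, hw, hlt⟩
    have h1 := risk_sub_minValue_le hf hG0 hG hv₀ hR hw.1
    have hnd : (n : ℝ) ≤ d := by exact_mod_cast hdn.le
    have h2 : 1 / 2 ≤ L / n := by
      rw [le_div_iff₀ hn0]
      nlinarith
    have h3 : 4 * (R * G) ≤ ermConst α G R := by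
      unfold ermConst
      have : 0 ≤ 6 * G + 2 * entropyConst R * (2 * G ^ 2 * α + G * (2 * R)) := by positivity
      linarith
    have h4 : 4 * (R * G) * (1 / 2) ≤ ermConst α G R * (L / n) := by gcongr
    linarith
  obtain ⟨A, hAW, hA, hcard, hnet⟩ := exists_fine_net ⟨v₀, hv₀.1⟩ hR hn hdn
  have hA0 : (0 : ℝ) < A.card := by exact_mod_cast hA.card_pos
  -- With `l = 1 / B`, the choice of `τ` makes half of `n * l * D` pay for the entropy and
  -- confidence `K * L` and for the discretization `G / B`.
  refine (measure_mono ?_).trans (iidLaw_erm_le (μ := μ) hf hG0.le hG hAW hA hnet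
    (by omega : 0 < n) hδ (p := minValue (risk μ f) W) (τ := 2 * (G + K * L * B) / n) ?_)
  · rintro z ⟨w, hw, hlt⟩
    refine ⟨w, hw, lt_of_le_of_lt ?_ hlt⟩
    have h1 : G * (1 / (n : ℝ) ^ 2) ≤ G / n := by
      rw [mul_one_div]
      gcongr
      have : (1 : ℝ) ≤ n := by exact_mod_cast (by omega : 1 ≤ n)
      nlinarith
    have h2 : 2 * (G + K * L * B) + G ≤ ermConst α G R * L := by
      unfold ermConst
      rw [← hK, ← hB]
      have : 0 ≤ R * G * L := by positivity
      nlinarith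
    calc 2 * (G + K * L * B) / n + G * (1 / (n : ℝ) ^ 2)
        ≤ 2 * (G + K * L * B) / n + G / n := by gcongr
      _ = (2 * (G + K * L * B) + G) / n := by ring
      _ ≤ ermConst α G R * L / n := by gcongr
      _ = _ := mul_div_assoc _ _ _
  · intro u hu hτ
    obtain ⟨v, hv, hle⟩ := hebc u (hAW hu)
    rw [minValue_eq hv.1] at hτ
    rw [Real.rpow_one] at hle
    have huv : ‖u - v‖ ≤ 2 * R := (norm_sub_le _ _).trans
      (by linarith [hR u (hAW hu), hR v hv.1.1])
    refine ⟨v, hv.1.1, 1 / B, by positivity, _,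
      lintegral_exp_loss_sub_le_of_sq hf hG0 hG (hAW hu) hv.1.1 hα huv hle rfl, ?_⟩
    have hlogA : Real.log (δ / A.card) = -(Real.log (1 / δ) + Real.log A.card) := by
      rw [Real.log_div hδ.ne' hA0.ne', one_div, Real.log_inv]
      ring
    have h1 : Real.log (1 / δ) + Real.log A.card ≤ K * L := by
      rw [hL, mul_add]
      nlinarith
    rw [div_lt_iff₀ hn0] at hτ
    have h2 : n * (G * (1 / (n : ℝ) ^ 2)) ≤ G := by
      rw [mul_one_div, mul_div_assoc', div_le_iff₀ (by positivity)]
      have : (1 : ℝ) ≤ n := by exact_mod_cast (by omega : 1 ≤ n)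
      nlinarith [mul_le_mul_of_nonneg_left this (mul_nonneg hn0.le hG0.le)]
    rw [hlogA]
    have h3 : n * (-(1 / B * (risk μ f u - risk μ f v)) / 2) + 1 / B * G ≤ -(K * L) := by
      have : n * (-(1 / B * (risk μ f u - risk μ f v)) / 2) + 1 / B * G =
          (-(((risk μ f u - risk μ f v) * n)) / 2 + G) / B := by ring
      rw [this, div_le_iff₀ hB0]
      linarith
    have h4 : 1 / B * (n * (G * (1 / (n : ℝ) ^ 2))) ≤ 1 / B * G := by gcongr
    linarith

/-- The constant in the fast rate of empirical risk minimization under weak sharp minima. -/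
def sharpConst (κ G R : ℝ) : ℝ :=
  20 * G + 2 * (R * G) * (8 * G ^ 2 * κ ^ 2 * entropyConst R) ^ 2 + 8 * (R * G)

theorem sharpConst_nonneg (κ : ℝ) {G R : ℝ} (hG : 0 ≤ G) (hR : 0 ≤ R) : 0 ≤ sharpConst κ G R := by
  unfold sharpConst
  positivity

/-- Under weak sharp minima, empirical risk minimization has a rate faster than `(d / n) ^ 2`. -/
theorem iidLaw_erm_sharp_le (hf : ∀ w ∈ W, Integrable (f w) μ) (hG0 : 0 < G)
    (hG : IsLipschitzLoss f W G) (hmin : (argminOn (risk μ f) W).Nonempty) {κ : ℝ} (hκ : 0 < κ)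
    (hs : WeakSharpMinima (risk μ f) W κ) {R : ℝ} (hR : ∀ w ∈ W, ‖w‖ ≤ R) {n : ℕ} (hn : 2 ≤ n)
    {δ : ℝ} (hδ : 0 < δ) (hδ1 : δ < 1) :
    iidLaw μ {z | ∃ w ∈ argminOn (empRisk f n z) W,
      sharpConst κ G R * ((d * Real.log n + Real.log (1 / δ)) / n) ^ 2 <
        risk μ f w - minValue (risk μ f) W} ≤ ENNReal.ofReal δ := by
  obtain ⟨v₀, hv₀⟩ := hmin
  have hR0 : 0 ≤ R := (norm_nonneg _).trans (hR v₀ hv₀.1)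
  have hn0 : (0 : ℝ) < n := by positivity
  have hlogn := half_le_log_of_two_le hn
  have hlogδ : 0 < Real.log (1 / δ) := Real.log_pos (by rw [lt_div_iff₀ hδ]; linarith)
  set K := entropyConst R with hK
  have hK1 : 1 ≤ K := one_le_entropyConst R
  set L : ℝ := d * Real.log n + Real.log (1 / δ) with hL
  have hL0 : 0 < L := by positivity
  set H : ℝ := 8 * G ^ 2 * κ ^ 2 * K with hH
  have hH0 : 0 < H := by positivity
  have hCdef : sharpConst κ G R = 20 * G + 2 * (R * G) * H ^ 2 + 8 * (R * G) := rfl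
  have hC0 : 0 ≤ sharpConst κ G R := sharpConst_nonneg κ hG0.le hR0
  rcases Nat.eq_zero_or_pos d with hd | hd
  · refine le_of_eq_of_le (iidLaw_eq_zero_of_imp_false ?_) zero_le
    rintro z ⟨w, -, hlt⟩
    have : Subsingleton (EuclideanSpace ℝ (Fin d)) := by subst hd; infer_instance
    rw [sub_minValue_eq_zero_of_subsingleton hv₀] at hlt
    exact absurd hlt (not_lt.2 (by positivity))
  have hd1 : (1 : ℝ) ≤ d := by exact_mod_cast hd
  have hL1 : 1 / 2 ≤ L := by nlinarith
  have htriv : 2 * (R * G) ≤ sharpConst κ G R * (L / n) ^ 2 →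
      iidLaw μ {z | ∃ w ∈ argminOn (empRisk f n z) W, sharpConst κ G R * (L / n) ^ 2 <
        risk μ f w - minValue (risk μ f) W} ≤ ENNReal.ofReal δ := fun h => by
    refine le_of_eq_of_le (iidLaw_eq_zero_of_imp_false ?_) zero_le
    rintro z ⟨w, hw, hlt⟩
    linarith [risk_sub_minValue_le hf hG0 hG hv₀ hR hw.1]
  have hRG : 0 ≤ R * G := by positivity
  rcases lt_or_ge n d with hdn | hdn
  · refine htriv ?_
    have hnd : (n : ℝ) ≤ d := by exact_mod_cast hdn.le
    have h2 : 1 / 2 ≤ L / n := by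
      rw [le_div_iff₀ hn0]
      nlinarith
    have h3 : 8 * (R * G) ≤ sharpConst κ G R := by
      rw [hCdef]
      have : 0 ≤ 2 * (R * G) * H ^ 2 := by positivity
      linarith
    calc 2 * (R * G) = 8 * (R * G) * (1 / 2) ^ 2 := by ring
      _ ≤ sharpConst κ G R * (L / n) ^ 2 := by gcongr
  -- For small `n` the right side is already at least the trivial bound. Otherwise the exponent, of
  -- order `n / (G * κ) ^ 2`, beats the entropy uniformly in `D`.
  rcases lt_or_ge (n : ℝ) (H * L) with hnL | hnL
  · refine htriv ?_
    have h2 : 1 / H ≤ L / n := by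
      rw [div_le_div_iff₀ hH0 hn0]
      linarith
    have h3 : 2 * (R * G) * H ^ 2 ≤ sharpConst κ G R := by
      rw [hCdef]
      linarith
    calc 2 * (R * G) = 2 * (R * G) * H ^ 2 * (1 / H) ^ 2 := by field_simp
      _ ≤ sharpConst κ G R * (L / n) ^ 2 := by gcongr
  obtain ⟨A, hAW, hA, hcard, hnet⟩ := exists_fine_net ⟨v₀, hv₀.1⟩ hR hn hdn
  have hA0 : (0 : ℝ) < A.card := by exact_mod_cast hA.card_pos
  -- `τ` is four times the discretization error, so that error uses up at most half of the exponent;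
  -- the other half is at least `K * L` by `hnL`.
  refine (measure_mono ?_).trans (iidLaw_erm_le (μ := μ) hf hG0.le hG hAW hA hnet
    (by omega : 0 < n) hδ (p := minValue (risk μ f) W) (τ := 4 * (G * (1 / (n : ℝ) ^ 2))) ?_)
  · rintro z ⟨w, hw, hlt⟩
    refine ⟨w, hw, lt_of_le_of_lt ?_ hlt⟩
    have h3 : 20 * G ≤ sharpConst κ G R := by
      rw [hCdef]
      have : 0 ≤ 2 * (R * G) * H ^ 2 := by positivity
      linarith
    calc 4 * (G * (1 / (n : ℝ) ^ 2)) + G * (1 / (n : ℝ) ^ 2)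
        = 20 * G * ((1 / 2) / n) ^ 2 := by ring
      _ ≤ sharpConst κ G R * (L / n) ^ 2 := by gcongr
  · intro u hu hτ
    obtain ⟨v, hv, hle⟩ := hs u (hAW hu)
    rw [minValue_eq hv.1] at hτ
    have hε0 : 0 < G * (1 / (n : ℝ) ^ 2) := by positivity
    set ε := G * (1 / (n : ℝ) ^ 2) with hε
    have hD : 0 < risk μ f u - risk μ f v := by linarith
    refine ⟨v, hv.1.1, 1 / (2 * G ^ 2 * κ ^ 2 * (risk μ f u - risk μ f v)), by positivity, _,
      lintegral_exp_loss_sub_le_of_sharp hf hG0 hG (hAW hu) hv.1.1 hκ hD hle rfl, ?_⟩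
    set D := risk μ f u - risk μ f v with hDdef
    have hlogA : Real.log (δ / A.card) = -(Real.log (1 / δ) + Real.log A.card) := by
      rw [Real.log_div hδ.ne' hA0.ne', one_div, Real.log_inv]
      ring
    have h1 : Real.log (1 / δ) + Real.log A.card ≤ K * L := by
      rw [hL, mul_add]
      nlinarith
    have hQ : 0 < 2 * G ^ 2 * κ ^ 2 := by positivity
    have h2 : 1 / (2 * G ^ 2 * κ ^ 2 * D) * (n * ε) ≤ n / (4 * (2 * G ^ 2 * κ ^ 2)) := by
      rw [div_mul_eq_mul_div, div_le_div_iff₀ (by positivity) (by positivity)]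
      have : n * (2 * G ^ 2 * κ ^ 2) * (4 * ε) ≤ n * (2 * G ^ 2 * κ ^ 2) * D := by gcongr
      linarith
    have h3 : n * (-(1 / (2 * G ^ 2 * κ ^ 2 * D) * D) / 2) = -(n / (2 * (2 * G ^ 2 * κ ^ 2))) := by
      field_simp
    have h4 : K * L ≤ n / (4 * (2 * G ^ 2 * κ ^ 2)) := by
      rw [le_div_iff₀ (by positivity)]
      rw [hH] at hnL
      linarith
    have h5 : n / (2 * (2 * G ^ 2 * κ ^ 2)) = 2 * (n / (4 * (2 * G ^ 2 * κ ^ 2))) := by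
      field_simp
      norm_num
    rw [hlogA, h3, h5]
    linarith

end Rates

/-! ### Projections and their dependence on the point and on the ball. -/

section Projection

variable {E : Type*} [NormedAddCommGroup E] [InnerProductSpace ℝ E] {K K' W : Set E}

theorem IsNearest.inner_le (hK : Convex ℝ K) {x y u : E} (h : IsNearest K x y) (hu : u ∈ K) :
    inner ℝ (x - y) (u - y) ≤ 0 := by
  refine (norm_eq_iInf_iff_real_inner_le_zero hK h.1).1 ?_ u hu
  have : Nonempty K := ⟨⟨y, h.1⟩⟩
  exact le_antisymm (le_ciInf fun w => h.2 w w.2)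
    (ciInf_le ⟨0, by rintro _ ⟨w, rfl⟩; exact norm_nonneg _⟩ (⟨y, h.1⟩ : K))

theorem IsNearest.norm_sub_le (hK : Convex ℝ K) {x y u : E} (h : IsNearest K x y) (hu : u ∈ K) :
    ‖y - u‖ ≤ ‖x - u‖ := by
  have h1 := h.inner_le hK hu
  have h2 : x - u = (x - y) - (u - y) := by abel
  have h3 := norm_sub_sq_real (x - y) (u - y)
  rw [← h2, norm_sub_rev u y] at h3
  refine le_of_sq_le_sq ?_ (norm_nonneg _)
  nlinarith [sq_nonneg ‖x - y‖]

/-- Stability of nearest points under perturbations of the point and of the convex set. -/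
theorem IsNearest.norm_sub_sq_le (hK : Convex ℝ K) (hK' : Convex ℝ K') {x y x' y' : E}
    (h : IsNearest K x y) (h' : IsNearest K' x' y') {η : ℝ} (hη : ∃ u ∈ K, ‖u - y'‖ ≤ η)
    (hη' : ∃ u ∈ K', ‖u - y‖ ≤ η) :
    ‖y - y'‖ ^ 2 ≤ ‖x - x'‖ * ‖y - y'‖ + η * (‖x - y‖ + ‖x' - y'‖) := by
  obtain ⟨u, hu, hle⟩ := hη
  obtain ⟨u', hu', hle'⟩ := hη'
  -- `y'` need not lie in `K`, so the variational inequality is applied to a nearby `u ∈ K`, at the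
  -- cost of `‖x - y‖ * η`.
  have h1 : inner ℝ (x - y) (y' - y) ≤ ‖x - y‖ * η := by
    have e : y' - y = (u - y) - (u - y') := by abel
    have := (abs_le.1 (abs_real_inner_le_norm (x - y) (u - y'))).1
    rw [e, inner_sub_right]
    nlinarith [h.inner_le hK hu, norm_nonneg (x - y)]
  have h2 : inner ℝ (x' - y') (y - y') ≤ ‖x' - y'‖ * η := by
    have e : y - y' = (u' - y') - (u' - y) := by abel
    have := (abs_le.1 (abs_real_inner_le_norm (x' - y') (u' - y))).1
    rw [e, inner_sub_right]
    nlinarith [h'.inner_le hK' hu', norm_nonneg (x' - y')]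
  have h3 : ‖y - y'‖ ^ 2 = inner ℝ (x - x') (y - y') + inner ℝ (x - y) (y' - y)
      + inner ℝ (x' - y') (y - y') := by
    rw [← neg_sub y y', inner_neg_right, ← sub_eq_add_neg, ← inner_sub_left, ← inner_add_left,
      ← real_inner_self_eq_norm_sq]
    congr 1
    abel
  linarith [real_inner_le_norm (x - x') (y - y')]

theorem proj_isNearest {E : Type*} [NormedAddCommGroup E] {K : Set E} {x : E}
    (h : ∃ y, IsNearest K x y) : IsNearest K x (proj K x) := by
  unfold proj
  rw [dif_pos h]
  exact h.choose_spec

theorem proj_isNearest_of_isCompact {E : Type*} [NormedAddCommGroup E] {K : Set E}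
    (hK : IsCompact K) (hne : K.Nonempty) (x : E) :
    IsNearest K x (proj K x) :=
  proj_isNearest (exists_isNearest hK hne x)

theorem continuous_proj (hK : IsCompact K) (hne : K.Nonempty) (hc : Convex ℝ K) :
    Continuous (proj K) := by
  have hlip : LipschitzWith 1 (proj K) := LipschitzWith.of_dist_le_mul fun x x' => by
    have h := proj_isNearest_of_isCompact hK hne x
    have h' := proj_isNearest_of_isCompact hK hne x'
    have := h.norm_sub_sq_le hc hc h' (η := 0) ⟨_, h'.1, by simp⟩ ⟨_, h.1, by simp⟩
    rw [dist_eq_norm, dist_eq_norm, NNReal.coe_one, one_mul]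
    rcases (norm_nonneg (proj K x - proj K x')).eq_or_lt with h0 | h0
    · rw [← h0]; exact norm_nonneg _
    · refine le_of_mul_le_mul_right ?_ h0
      nlinarith
  exact hlip.continuous

/-- Pulling `y` towards `c'` by the fraction `η / (r + η)` brings it into the new ball, convexity
keeps it in `W`, and it moves by at most `η`. This gives continuity, hence measurability, of
projections onto balls with random centres. -/
theorem exists_mem_ball_inter_near (hW : Convex ℝ W) {c c' y : E} {r : ℝ} (hr : 0 < r)
    (hc' : c' ∈ W) (hy : y ∈ W ∩ Metric.closedBall c r) :
    ∃ u ∈ W ∩ Metric.closedBall c' r, ‖u - y‖ ≤ ‖c - c'‖ := by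
  set η := ‖c - c'‖ with hη
  have hη0 : 0 ≤ η := norm_nonneg _
  have hyc : ‖y - c'‖ ≤ r + η := by
    have h1 : ‖y - c‖ ≤ r := by simpa [dist_eq_norm] using hy.2
    have h2 : y - c' = (y - c) + (c - c') := by abel
    rw [h2]
    exact (norm_add_le _ _).trans (by linarith)
  have hs0 : 0 < r + η := by linarith
  refine ⟨y + (η / (r + η)) • (c' - y), ⟨hW.add_smul_sub_mem hy.1 hc' ⟨by positivity, ?_⟩, ?_⟩, ?_⟩
  · rw [div_le_one hs0]; linarith
  · rw [Metric.mem_closedBall, dist_eq_norm]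
    have e : y + (η / (r + η)) • (c' - y) - c' = (1 - η / (r + η)) • (y - c') := by module
    have e2 : 1 - η / (r + η) = r / (r + η) := by field_simp; ring
    rw [e, e2, norm_smul, Real.norm_of_nonneg (by positivity), div_mul_eq_mul_div,
      div_le_iff₀ hs0]
    gcongr
  · rw [add_sub_cancel_left, norm_smul, Real.norm_of_nonneg (by positivity), div_mul_eq_mul_div,
      div_le_iff₀ hs0, norm_sub_rev]
    gcongr

/-- Projections onto `W ∩ B(c, r)` depend continuously on the centre `c ∈ W` and the point. -/
theorem continuous_proj_ball (hWc : IsCompact W) (hW : Convex ℝ W) {r : ℝ} (hr : 0 < r) :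
    Continuous fun p : W × E => proj (W ∩ Metric.closedBall (p.1 : E) r) p.2 := by
  have hnear : ∀ p : W × E, IsNearest (W ∩ Metric.closedBall (p.1 : E) r) p.2
      (proj (W ∩ Metric.closedBall (p.1 : E) r) p.2) := fun p =>
    proj_isNearest_of_isCompact (hWc.inter_right Metric.isClosed_closedBall)
      ⟨p.1, p.1.2, Metric.mem_closedBall_self hr.le⟩ _
  have hconv : ∀ p : W × E, Convex ℝ (W ∩ Metric.closedBall (p.1 : E) r) := fun p =>
    hW.inter (convex_closedBall _ _)
  obtain ⟨D, hD⟩ := hWc.isBounded.exists_norm_le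
  refine continuous_iff_continuousAt.2 fun p => ?_
  set P := fun p : W × E => proj (W ∩ Metric.closedBall (p.1 : E) r) p.2 with hP
  have hPD : ∀ q, ‖P q‖ ≤ D := fun q => hD _ (hnear q).1.1
  have hbound : ∀ q : W × E, ‖P q - P p‖ ^ 2 ≤
      ‖q.2 - p.2‖ * (2 * D) + ‖(q.1 : E) - p.1‖ * ((‖q.2‖ + D) + (‖p.2‖ + D)) := fun q => by
    have h := (hnear q).norm_sub_sq_le (hconv q) (hconv p) (hnear p) (η := ‖(q.1 : E) - p.1‖)
      (by
        rw [norm_sub_rev]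
        exact exists_mem_ball_inter_near hW hr q.1.2 (hnear p).1)
      (exists_mem_ball_inter_near hW hr p.1.2 (hnear q).1)
    have h1 : ‖P q - P p‖ ≤ 2 * D := (norm_sub_le _ _).trans (by linarith [hPD q, hPD p])
    have h2 : ‖q.2 - P q‖ ≤ ‖q.2‖ + D := (norm_sub_le _ _).trans (by linarith [hPD q])
    have h3 : ‖p.2 - P p‖ ≤ ‖p.2‖ + D := (norm_sub_le _ _).trans (by linarith [hPD p])
    refine h.trans ?_
    gcongr
  have hlim : Filter.Tendsto (fun q : W × E => ‖q.2 - p.2‖ * (2 * D) +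
      ‖(q.1 : E) - p.1‖ * ((‖q.2‖ + D) + (‖p.2‖ + D))) (nhds p) (nhds 0) := by
    have hc : Continuous fun q : W × E => ‖q.2 - p.2‖ * (2 * D) +
      ‖(q.1 : E) - p.1‖ * ((‖q.2‖ + D) + (‖p.2‖ + D)) := by fun_prop
    have := hc.tendsto p
    simpa using this
  have hsq : Filter.Tendsto (fun q => ‖P q - P p‖ ^ 2) (nhds p) (nhds 0) :=
    squeeze_zero (fun _ => sq_nonneg _) hbound hlim
  refine tendsto_iff_norm_sub_tendsto_zero.2 ?_
  have := hsq.sqrt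
  simpa [Real.sqrt_sq (norm_nonneg _)] using this

end Projection

/-! ### Averaging stochastic subgradients. -/

section Oracle

variable {E : Type*} [NormedAddCommGroup E] [InnerProductSpace ℝ E] [FiniteDimensional ℝ E]
  [MeasurableSpace E] [BorelSpace E] {Z : Type*} [MeasurableSpace Z] {μ : Measure Z}
  [IsProbabilityMeasure μ] {f : E → Z → ℝ} {W : Set E} {G : ℝ} {g : E → Z → E}

theorem IsSubgradientOracle.integrable (hg : IsSubgradientOracle μ f W G g) {w : E} (hw : w ∈ W) :
    Integrable (g w) μ :=
  Integrable.of_bound (hg.1.comp measurable_prodMk_left).aestronglyMeasurable G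
    (Filter.Eventually.of_forall (hg.2 w hw).1)

/-- The mean of a subgradient oracle is a subgradient of a convex risk. -/
theorem IsSubgradientOracle.risk_sub_le (hg : IsSubgradientOracle μ f W G g)
    (hf : ∀ w ∈ W, Integrable (f w) μ) (hG : IsLipschitzLoss f W G)
    (hP : ConvexOn ℝ W (risk μ f)) {w u : E} (hw : w ∈ W) (hu : u ∈ W) :
    risk μ f w - risk μ f u ≤ inner ℝ (∫ z, g w z ∂μ) (w - u) := by
  have hgi := hg.integrable hw
  obtain ⟨hgb, hsub | hsub⟩ := hg.2 w hw
  swap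
  · have := (mem_subdiff_iff hP hw).1 hsub u hu
    rw [← neg_sub u w, inner_neg_right]
    linarith
  set a : ℕ → ℝ := fun k => 1 / ((k : ℝ) + 1) with ha
  have ha0 : ∀ k, 0 < a k := fun k => by simp only [ha]; positivity
  have ha1 : ∀ k, a k ≤ 1 := fun k => by
    simp only [ha]
    rw [div_le_one (by positivity)]
    linarith [Nat.cast_nonneg (α := ℝ) k]
  set x : ℕ → E := fun k => w + a k • (u - w) with hx
  have hxW : ∀ k, x k ∈ W := fun k => hP.1.add_smul_sub_mem hw hu ⟨(ha0 k).le, ha1 k⟩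
  have hxw : ∀ k, x k - w = a k • (u - w) := fun k => add_sub_cancel_left _ _
  have hxlim : Filter.Tendsto x Filter.atTop (nhdsWithin w W) := by
    refine tendsto_nhdsWithin_iff.2 ⟨?_, Filter.Eventually.of_forall hxW⟩
    have h1 := (tendsto_one_div_add_atTop_nhds_zero_nat (𝕜 := ℝ)).smul_const (u - w)
    simpa [hx, ha] using h1.const_add w
  -- Difference quotient of the loss along the segment minus the linear prediction. Its mean is
  -- controlled by convexity of the risk alone; the individual losses need not be convex.
  set φ : ℕ → Z → ℝ := fun k z => (a k)⁻¹ * (f (x k) z - f w z) - inner ℝ (g w z) (u - w) with hφ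
  have hini : Integrable (fun z => (inner ℝ (g w z) (u - w) : ℝ)) μ := hgi.inner_const _
  have hφi : ∀ k, Integrable (φ k) μ := fun k =>
    (((hf _ (hxW k)).sub (hf w hw)).const_mul _).sub hini
  have hmean : ∀ k, ∫ z, φ k z ∂μ ≤
      risk μ f u - risk μ f w - inner ℝ (∫ z, g w z ∂μ) (u - w) := fun k => by
    have h1 : ∫ z, φ k z ∂μ = (a k)⁻¹ * (risk μ f (x k) - risk μ f w) -
        inner ℝ (∫ z, g w z ∂μ) (u - w) := by
      simp only [hφ]
      have h2 : Integrable (fun z => (a k)⁻¹ * (f (x k) z - f w z)) μ :=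
        ((hf _ (hxW k)).sub (hf w hw)).const_mul _
      rw [integral_sub h2 hini, integral_const_mul,
        integral_sub (hf _ (hxW k)) (hf w hw)]
      congr 1
      simp only [real_inner_comm (u - w)]
      exact integral_inner hgi (u - w)
    have h2 := hP.2 hw hu (sub_nonneg.2 (ha1 k)) (ha0 k).le (by ring)
    have e : (1 - a k) • w + a k • u = x k := by simp only [hx]; module
    rw [e] at h2
    simp only [smul_eq_mul] at h2
    have h3 : (a k)⁻¹ * (risk μ f (x k) - risk μ f w) ≤ risk μ f u - risk μ f w := by
      rw [inv_mul_le_iff₀ (ha0 k)]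
      linarith
    linarith
  -- A regular subgradient controls `φ` only from below, so dominated convergence is applied to its
  -- negative part.
  have hlow : ∀ z, Filter.Tendsto (fun k => min (φ k z) 0) Filter.atTop (nhds 0) := fun z => by
    refine (Metric.tendsto_nhds).2 fun ε hε => ?_
    have h1 := hxlim.eventually (hsub z (ε / (2 * (‖u - w‖ + 1))) (by positivity))
    filter_upwards [h1] with k hk
    simp only [hxw, inner_smul_right, norm_smul, Real.norm_of_nonneg (ha0 k).le] at hk
    have h2 : -(ε / 2) ≤ φ k z := by
      have h3 : ε / (2 * (‖u - w‖ + 1)) * ‖u - w‖ ≤ ε / 2 := by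
        rw [div_mul_eq_mul_div, div_le_div_iff₀ (by positivity) two_pos]
        nlinarith [norm_nonneg (u - w)]
      have h4 : (a k)⁻¹ * (a k * (inner ℝ (g w z) (u - w) -
          ε / (2 * (‖u - w‖ + 1)) * ‖u - w‖)) ≤ (a k)⁻¹ * (f (x k) z - f w z) :=
        mul_le_mul_of_nonneg_left (by linarith) (inv_nonneg.2 (ha0 k).le)
      rw [inv_mul_cancel_left₀ (ha0 k).ne'] at h4
      simp only [hφ]
      linarith
    have h5 : -(ε / 2) ≤ min (φ k z) 0 := le_min h2 (by linarith)
    rw [Real.dist_eq, sub_zero, abs_of_nonpos (min_le_right _ _)]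
    linarith
  have hbd : ∀ k z, ‖min (φ k z) 0‖ ≤ G * ‖u - w‖ + G * ‖u - w‖ := fun k z => by
    have h1 : |min (φ k z) 0| ≤ |φ k z| := by
      rcases le_total (φ k z) 0 with h | h
      · rw [min_eq_left h]
      · rw [min_eq_right h, abs_zero]; exact abs_nonneg _
    refine h1.trans ((abs_sub _ _).trans (add_le_add ?_ ?_))
    · rw [abs_mul, abs_of_pos (inv_pos.2 (ha0 k)), inv_mul_le_iff₀ (ha0 k)]
      refine (hG z _ (hxW k) w hw).trans_eq ?_
      rw [hxw, norm_smul, Real.norm_of_nonneg (ha0 k).le]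
      ring
    · exact (abs_real_inner_le_norm _ _).trans
        (mul_le_mul_of_nonneg_right (hgb z) (norm_nonneg _))
  have hdct := tendsto_integral_of_dominated_convergence (μ := μ)
    (fun _ => G * ‖u - w‖ + G * ‖u - w‖)
    (fun k => ((hφi k).inf (integrable_zero _ _ _)).aestronglyMeasurable) (integrable_const _)
    (fun k => Filter.Eventually.of_forall (hbd k)) (Filter.Eventually.of_forall hlow)
  rw [integral_zero] at hdct
  have hfin := le_of_tendsto hdct (Filter.Eventually.of_forall fun k =>
    (integral_mono ((hφi k).inf (integrable_zero _ _ _)) (hφi k)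
      (fun z => min_le_left _ _)).trans (hmean k))
  rw [← neg_sub u w, inner_neg_right]
  linarith

/-- Hoeffding's bound on the exponential moment of a bounded centred variable. -/
theorem lintegral_exp_mul_le_of_abs_le {X : Z → ℝ} (hX : Measurable X) {c : ℝ} (hc0 : 0 ≤ c)
    (hc : ∀ x, |X x| ≤ c) (h0 : ∫ x, X x ∂μ = 0) (l : ℝ) :
    ∫⁻ x, ENNReal.ofReal (Real.exp (l * X x)) ∂μ ≤
      ENNReal.ofReal (Real.exp (c ^ 2 * l ^ 2 / 2)) := by
  have h := ProbabilityTheory.hasSubgaussianMGF_of_mem_Icc_of_integral_eq_zero (μ := μ)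
    (a := -c) (b := c) hX.aemeasurable
    (Filter.Eventually.of_forall fun x => abs_le.1 (hc x)) h0
  have h1 := h.mgf_le l
  rw [← ofReal_integral_eq_lintegral_ofReal (h.integrable_exp_mul l)
    (Filter.Eventually.of_forall fun x => (Real.exp_pos _).le)]
  refine ENNReal.ofReal_le_ofReal (h1.trans_eq ?_)
  congr 3
  have : ‖c - -c‖ = 2 * c := by
    rw [sub_neg_eq_add, Real.norm_of_nonneg (by linarith)]; ring
  push_cast
  rw [this]
  ring

end Oracle

/-! ### Deterministic regret of the projected subgradient method. -/

section Regret

variable {E : Type*} [NormedAddCommGroup E] [InnerProductSpace ℝ E] {Z : Type*}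

theorem ssgIter_mem {g : E → Z → E} {K : Set E} (hK : IsCompact K) {γ : ℝ} {w₁ : E} (hw₁ : w₁ ∈ K)
    (z : ℕ → Z) (t : ℕ) : ssgIter g K γ w₁ z t ∈ K := by
  cases t with
  | zero => exact hw₁
  | succ t => exact (proj_isNearest_of_isCompact hK ⟨w₁, hw₁⟩ _).1

theorem ssgIter_congr {g : E → Z → E} {K : Set E} {γ : ℝ} {w₁ : E} {z z' : ℕ → Z} {t : ℕ}
    (h : ∀ i < t, z i = z' i) : ssgIter g K γ w₁ z t = ssgIter g K γ w₁ z' t := by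
  induction t with
  | zero => rfl
  | succ t ih =>
    simp only [ssgIter]
    rw [ih fun i hi => h i (by omega), h t (by omega)]

/-- The regret bound of the projected subgradient method. -/
theorem sum_inner_ssgIter_le {g : E → Z → E} {K : Set E} (hK : IsCompact K) (hKc : Convex ℝ K)
    {G γ : ℝ} (hγ : 0 < γ) (hG : ∀ w ∈ K, ∀ z, ‖g w z‖ ≤ G) {w₁ : E} (hw₁ : w₁ ∈ K) {u : E}
    (hu : u ∈ K) (z : ℕ → Z) (N : ℕ) :
    ∑ t ∈ Finset.range N, inner ℝ (g (ssgIter g K γ w₁ z t) (z t)) (ssgIter g K γ w₁ z t - u) ≤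
      ‖w₁ - u‖ ^ 2 / (2 * γ) + N * (γ * G ^ 2 / 2) := by
  -- The final distance is kept so that the one-step inequalities telescope in the induction.
  suffices h : ∑ t ∈ Finset.range N,
      inner ℝ (g (ssgIter g K γ w₁ z t) (z t)) (ssgIter g K γ w₁ z t - u) ≤
      (‖w₁ - u‖ ^ 2 - ‖ssgIter g K γ w₁ z N - u‖ ^ 2) / (2 * γ) + N * (γ * G ^ 2 / 2) by
    refine h.trans ?_
    gcongr
    linarith [sq_nonneg ‖ssgIter g K γ w₁ z N - u‖]
  induction N with
  | zero => simp [ssgIter]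
  | succ N ih =>
    rw [Finset.sum_range_succ]
    set v := ssgIter g K γ w₁ z N with hv
    have hvK : v ∈ K := ssgIter_mem hK hw₁ z N
    have hstep : ‖ssgIter g K γ w₁ z (N + 1) - u‖ ≤ ‖v - γ • g v (z N) - u‖ :=
      (proj_isNearest_of_isCompact hK ⟨w₁, hw₁⟩ _).norm_sub_le hKc hu
    have hsq : ‖v - γ • g v (z N) - u‖ ^ 2 =
        ‖v - u‖ ^ 2 - 2 * γ * inner ℝ (g v (z N)) (v - u) + γ ^ 2 * ‖g v (z N)‖ ^ 2 := by
      have e : v - γ • g v (z N) - u = (v - u) - γ • g v (z N) := by abel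
      rw [e, norm_sub_sq_real, inner_smul_right, norm_smul, Real.norm_of_nonneg hγ.le,
        real_inner_comm (v - u)]
      ring
    have hgG : ‖g v (z N)‖ ^ 2 ≤ G ^ 2 := pow_le_pow_left₀ (norm_nonneg _) (hG v hvK _) 2
    have h1 := pow_le_pow_left₀ (norm_nonneg _) hstep 2
    rw [hsq] at h1
    have h2 : inner ℝ (g v (z N)) (v - u) ≤
        (‖v - u‖ ^ 2 - ‖ssgIter g K γ w₁ z (N + 1) - u‖ ^ 2) / (2 * γ) + γ * G ^ 2 / 2 := by
      rw [div_add' _ _ _ (by positivity), le_div_iff₀ (by positivity)]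
      nlinarith [mul_le_mul_of_nonneg_left hgG (sq_nonneg γ)]
    push_cast
    have h3 : (‖w₁ - u‖ ^ 2 - ‖ssgIter g K γ w₁ z (N + 1) - u‖ ^ 2) / (2 * γ) =
        (‖w₁ - u‖ ^ 2 - ‖v - u‖ ^ 2) / (2 * γ) +
        (‖v - u‖ ^ 2 - ‖ssgIter g K γ w₁ z (N + 1) - u‖ ^ 2) / (2 * γ) := by
      rw [← add_div]; congr 1; ring
    rw [h3]
    linarith

theorem ssg_mem {g : E → Z → E} {K : Set E} (hK : IsCompact K) (hKc : Convex ℝ K) {γ : ℝ} {w₁ : E}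
    (hw₁ : w₁ ∈ K) (z : ℕ → Z) (T : ℕ) : ssg g K γ w₁ z T ∈ K := by
  unfold ssg
  rw [Finset.smul_sum]
  refine hKc.sum_mem (fun _ _ => by positivity) ?_ fun t _ => ssgIter_mem hK hw₁ z t
  simp
  field_simp

theorem ssg_congr {g : E → Z → E} {K : Set E} {γ : ℝ} {w₁ : E} {z z' : ℕ → Z} {T : ℕ}
    (h : ∀ i < T, z i = z' i) : ssg g K γ w₁ z T = ssg g K γ w₁ z' T := by
  unfold ssg
  congr 1
  refine Finset.sum_congr rfl fun t ht => ssgIter_congr fun i hi => h i ?_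
  have := Finset.mem_range.1 ht
  omega

/-- Jensen's inequality for the averaged iterate. -/
theorem ConvexOn.ssg_sub_le {P : E → ℝ} {W : Set E} (hP : ConvexOn ℝ W P) {g : E → Z → E}
    {K : Set E} (hK : IsCompact K) (hKW : K ⊆ W) {γ : ℝ} {w₁ : E} (hw₁ : w₁ ∈ K) (z : ℕ → Z)
    (T : ℕ) (p : ℝ) :
    P (ssg g K γ w₁ z T) - p ≤
      (∑ t ∈ Finset.range (T + 1), (P (ssgIter g K γ w₁ z t) - p)) / (T + 1) := by
  have h := hP.map_sum_le (t := Finset.range (T + 1)) (w := fun _ => 1 / ((T : ℝ) + 1))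
    (p := ssgIter g K γ w₁ z) (fun _ _ => by positivity) (by simp; field_simp)
    fun t _ => hKW (ssgIter_mem hK hw₁ z t)
  rw [← Finset.smul_sum] at h
  rw [Finset.sum_sub_distrib, Finset.sum_const, Finset.card_range, nsmul_eq_mul, sub_div]
  push_cast
  rw [mul_div_cancel_left₀ _ (by positivity), Finset.sum_div]
  refine sub_le_sub_right (h.trans_eq (Finset.sum_congr rfl fun t _ => ?_)) p
  rw [smul_eq_mul, div_mul_eq_mul_div, one_mul]

end Regret

/-! ### Measurability and the high probability bound for one stage. -/

section Stage

variable {E : Type*} [NormedAddCommGroup E] [InnerProductSpace ℝ E] [FiniteDimensional ℝ E]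
  [MeasurableSpace E] [BorelSpace E] {Z : Type*} [MeasurableSpace Z] {W : Set E}

theorem measurable_proj_ball (hWc : IsCompact W) (hW : Convex ℝ W) {r : ℝ} (hr : 0 < r)
    {Ω : Type*} [MeasurableSpace Ω] {c x : Ω → E} (hc : Measurable c) (hcW : ∀ ω, c ω ∈ W)
    (hx : Measurable x) :
    Measurable fun ω => proj (W ∩ Metric.closedBall (c ω) r) (x ω) :=
  (continuous_proj_ball hWc hW hr).measurable.comp
    ((hc.subtype_mk (h := hcW)).prodMk hx)

theorem measurable_ssgIter (hWc : IsCompact W) (hW : Convex ℝ W) {r : ℝ} (hr : 0 < r)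
    {g : E → Z → E} (hg : Measurable (Function.uncurry g)) {c : (ℕ → Z) → E} (hc : Measurable c)
    (hcW : ∀ z, c z ∈ W) (γ : ℝ) (t₀ t : ℕ) :
    Measurable fun z : ℕ → Z => ssgIter g (W ∩ Metric.closedBall (c z) r) γ (c z)
      (fun i => z (t₀ + i)) t := by
  induction t with
  | zero => exact hc
  | succ t ih =>
    exact measurable_proj_ball hWc hW hr hc hcW
      (ih.sub ((hg.comp (ih.prodMk (measurable_pi_apply (t₀ + t)))).const_smul γ))

theorem measurable_ssg (hWc : IsCompact W) (hW : Convex ℝ W) {r : ℝ} (hr : 0 < r)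
    {g : E → Z → E} (hg : Measurable (Function.uncurry g)) {c : (ℕ → Z) → E} (hc : Measurable c)
    (hcW : ∀ z, c z ∈ W) (γ : ℝ) (t₀ T : ℕ) :
    Measurable fun z : ℕ → Z => ssg g (W ∩ Metric.closedBall (c z) r) γ (c z)
      (fun i => z (t₀ + i)) T :=
  (Finset.measurable_sum _ fun t _ => measurable_ssgIter hWc hW hr hg hc hcW γ t₀ t).const_smul _

variable {μ : Measure Z} [IsProbabilityMeasure μ] {f : E → Z → ℝ} {G : ℝ} {g : E → Z → E}

/-- High probability bound for the averaged projected stochastic subgradient method, started at a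
random point `c` and compared with a random point `u`, both determined by the samples before
`t₀`. -/
theorem iidLaw_ssg_le (hWc : IsCompact W) (hf : ∀ w ∈ W, Integrable (f w) μ) (hG0 : 0 < G)
    (hG : IsLipschitzLoss f W G) (hP : ConvexOn ℝ W (risk μ f))
    (hg : IsSubgradientOracle μ f W G g) {r : ℝ} (hr : 0 < r) {c u : (ℕ → Z) → E}
    (hc : Measurable c) (hcW : ∀ z, c z ∈ W) (hu : Measurable u)
    (huK : ∀ z, u z ∈ W ∩ Metric.closedBall (c z) r) {t₀ : ℕ}
    (hcdep : ∀ i ≥ t₀, ∀ z x, c (Function.update z i x) = c z)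
    (hudep : ∀ i ≥ t₀, ∀ z x, u (Function.update z i x) = u z) (T : ℕ) {L : ℝ} (hL : 1 ≤ L) :
    iidLaw μ {z | 7 * G * √L / √((T : ℝ) + 1) * r <
      risk μ f (ssg g (W ∩ Metric.closedBall (c z) r) (r / (G * √((T : ℝ) + 1))) (c z)
        (fun i => z (t₀ + i)) T) - risk μ f (u z)} ≤ ENNReal.ofReal (Real.exp (-L)) := by
  have hN0 : 0 < √((T : ℝ) + 1) := Real.sqrt_pos.2 (by positivity)
  have hNsq : √((T : ℝ) + 1) ^ 2 = T + 1 := Real.sq_sqrt (by positivity)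
  set S := √((T : ℝ) + 1) with hS
  have hL0 : 0 < √L := Real.sqrt_pos.2 (by linarith)
  have hLsq : √L ^ 2 = L := Real.sq_sqrt (by linarith)
  have hL1 : 1 ≤ √L := Real.one_le_sqrt.2 hL
  set γ := r / (G * S) with hγ
  have hγ0 : 0 < γ := by positivity
  set v : ℕ → (ℕ → Z) → E := fun t z => ssgIter g (W ∩ Metric.closedBall (c z) r) γ (c z)
    (fun i => z (t₀ + i)) t with hv
  have hKc : ∀ z, IsCompact (W ∩ Metric.closedBall (c z) r) := fun z =>
    hWc.inter_right Metric.isClosed_closedBall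
  have hKconv : ∀ z, Convex ℝ (W ∩ Metric.closedBall (c z) r) := fun z =>
    hP.1.inter (convex_closedBall _ _)
  have hcK : ∀ z, c z ∈ W ∩ Metric.closedBall (c z) r := fun z =>
    ⟨hcW z, Metric.mem_closedBall_self hr.le⟩
  have hvK : ∀ t z, v t z ∈ W ∩ Metric.closedBall (c z) r := fun t z =>
    ssgIter_mem (hKc z) (hcK z) _ t
  have hvm : ∀ t, Measurable (v t) := fun t =>
    measurable_ssgIter hWc hP.1 hr hg.1 hc hcW γ t₀ t
  have hvdep : ∀ t, ∀ i ≥ t₀ + t, ∀ z x, v t (Function.update z i x) = v t z :=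
    fun t i hi z x => by
      simp only [hv, hcdep i (by omega)]
      exact ssgIter_congr fun j hj => by rw [Function.update_of_ne (by omega)]
  set m : E → E := fun w => ∫ z, g w z ∂μ with hm
  have hmm : Measurable m :=
    (StronglyMeasurable.integral_prod_right hg.1.stronglyMeasurable).measurable
  -- The martingale difference: its first argument fixes the iterate and the comparator, its second
  -- is the fresh sample, over which the mean vanishes.
  set ξ : ℕ → (ℕ → Z) × Z → ℝ := fun t p =>
    inner ℝ (m (v t p.1) - g (v t p.1) p.2) (v t p.1 - u p.1) with hξ
  have hξm : ∀ t, Measurable (ξ t) := fun t => by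
    have h1 : Measurable fun p : (ℕ → Z) × Z => v t p.1 := (hvm t).comp measurable_fst
    exact ((hmm.comp h1).sub (hg.1.comp (h1.prodMk measurable_snd))).inner
      (h1.sub (hu.comp measurable_fst))
  have hdist : ∀ t z, ‖v t z - u z‖ ≤ 2 * r := fun t z => by
    have h1 := Metric.mem_closedBall.1 (hvK t z).2
    have h2 := Metric.mem_closedBall.1 (huK z).2
    rw [← dist_eq_norm]
    exact (dist_triangle_right _ _ (c z)).trans (by linarith)
  have hmG : ∀ w ∈ W, ‖m w‖ ≤ G := fun w hw => by
    have := norm_integral_le_of_norm_le_const (μ := μ)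
      (Filter.Eventually.of_forall (hg.2 w hw).1)
    simpa using this
  have hξb : ∀ t p, |ξ t p| ≤ 4 * G * r := fun t p => by
    have h1 : ‖m (v t p.1) - g (v t p.1) p.2‖ ≤ G + G := (norm_sub_le _ _).trans
      (add_le_add (hmG _ (hvK t p.1).1) ((hg.2 _ (hvK t p.1).1).1 p.2))
    calc |ξ t p| ≤ ‖m (v t p.1) - g (v t p.1) p.2‖ * ‖v t p.1 - u p.1‖ :=
          abs_real_inner_le_norm _ _
      _ ≤ (G + G) * (2 * r) := by gcongr; exact hdist t p.1
      _ = _ := by ring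
  have hξ0 : ∀ t z, ∫ x, ξ t (z, x) ∂μ = 0 := fun t z => by
    have hgi := hg.integrable (hvK t z).1
    have hint : Integrable (fun x => m (v t z) - g (v t z) x) μ := (integrable_const _).sub hgi
    simp only [hξ]
    simp only [real_inner_comm (v t z - u z)]
    rw [integral_inner hint, integral_sub (integrable_const _) hgi]
    simp [hm]
  -- Over the `T + 1 = S ^ 2` terms the exponential moments contribute `L / 2`, so the threshold `3
  -- / 2 * L` leaves `exp (-L)`. It corresponds to a deviation of `6 * G * r * S * √L`; the regret
  -- adds `r * G * S`, whence the constant 7.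
  set l := √L / (4 * G * r * S) with hl
  have hl0 : 0 < l := by positivity
  have htail := iidLaw_sum_ge_le μ t₀ (X := fun t p => l * ξ t p) (fun t => (hξm t).const_mul l)
    (fun t i hi z x y => by
      simp only [hξ, hvdep t i hi, hudep i (by omega)])
    (fun t z => lintegral_exp_mul_le_of_abs_le ((hξm t).comp measurable_prodMk_left)
      (by positivity : 0 ≤ 4 * G * r) (fun x => hξb t (z, x)) (hξ0 t z) l) (T + 1) (3 / 2 * L)
  have hexp : ((T + 1 : ℕ) : ℝ) * ((4 * G * r) ^ 2 * l ^ 2 / 2) - 3 / 2 * L = -L := by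
    push_cast
    rw [← hNsq, hl]
    field_simp
    rw [hLsq]
    ring
  rw [hexp] at htail
  refine (measure_mono ?_).trans htail
  intro z hz
  change 7 * G * √L / S * r < _ at hz
  show 3 / 2 * L ≤ ∑ t ∈ Finset.range (T + 1), l * ξ t (z, z (t₀ + t))
  rw [← Finset.mul_sum]
  have hJ := ConvexOn.ssg_sub_le hP (g := g) (hKc z) Set.inter_subset_left (γ := γ) (hcK z)
    (fun i => z (t₀ + i)) T (risk μ f (u z))
  -- All `T + 1` averaged iterates enter. The last one is paired with sample `t₀ + T`, which the
  -- stage itself never uses.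
  have hreg := sum_inner_ssgIter_le (g := g) (hKc z) (hKconv z) hγ0
    (fun w hw x => (hg.2 w hw.1).1 x) (hcK z) (huK z) (fun i => z (t₀ + i)) (T + 1)
  have hsub : ∑ t ∈ Finset.range (T + 1), (risk μ f (v t z) - risk μ f (u z)) ≤
      ∑ t ∈ Finset.range (T + 1), inner ℝ (g (v t z) (z (t₀ + t))) (v t z - u z) +
      ∑ t ∈ Finset.range (T + 1), ξ t (z, z (t₀ + t)) := by
    rw [← Finset.sum_add_distrib]
    refine Finset.sum_le_sum fun t _ => ?_
    refine (hg.risk_sub_le hf hG hP (hvK t z).1 (huK z).1).trans_eq ?_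
    simp only [hξ]
    rw [← inner_add_left, add_sub_cancel]
  have hcu : ‖c z - u z‖ ≤ r := by
    rw [← dist_eq_norm, dist_comm]
    exact Metric.mem_closedBall.1 (huK z).2
  have hreg2 : ‖c z - u z‖ ^ 2 / (2 * γ) + ((T + 1 : ℕ) : ℝ) * (γ * G ^ 2 / 2) ≤ r * G * S := by
    calc ‖c z - u z‖ ^ 2 / (2 * γ) + ((T + 1 : ℕ) : ℝ) * (γ * G ^ 2 / 2)
        ≤ r ^ 2 / (2 * γ) + S ^ 2 * (γ * G ^ 2 / 2) := by
          rw [hNsq]; push_cast; gcongr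
      _ = r * G * S := by rw [hγ]; field_simp; ring
  have hz' := hz.trans_le hJ
  rw [← hNsq, lt_div_iff₀ (by positivity)] at hz'
  have h7 : 7 * G * √L / S * r * S ^ 2 = 7 * G * √L * r * S := by field_simp
  rw [h7] at hz'
  have hX : 6 * G * r * S * √L ≤ ∑ t ∈ Finset.range (T + 1), ξ t (z, z (t₀ + t)) := by
    have h8 : r * G * S * 1 ≤ r * G * S * √L := by gcongr
    simp only [hv] at hsub
    linarith
  calc 3 / 2 * L = l * (6 * G * r * S * √L) := by
        rw [hl]
        field_simp
        rw [hLsq]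
        ring
    _ ≤ _ := by gcongr

end Stage

/-! ### The stage recursion and the numerical parameters. -/

section Parameters

/-- The recursion behind adaptive stochastic approximation: `D k` is the excess risk after `k`
stages and `e k` the distance to the optimal set. -/
theorem adaptive_stages_le {D e R : ℕ → ℝ} {α B : ℝ} {m : ℕ} (hα : 0 < α) (hB : 0 ≤ B)
    (hR0 : ∀ k, 0 ≤ R k) (hR : ∀ k, R (k + 1) = R k / 2) (heD : ∀ k, e k ^ 2 ≤ α * D k)
    (h0 : e 0 ≤ R 0) (hnear : ∀ k < m, e k ≤ R k → D (k + 1) ≤ B * R k)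
    (hfar : ∀ k < m, R k < e k → D (k + 1) ≤ D k + B * R k) (hm : 1 ≤ m) :
    D m ≤ max (8 * α * B ^ 2) (2 * B * R m) := by
  have hcases : ∀ k < m, e k ≤ R k →
      e (k + 1) ≤ R (k + 1) ∨ D (k + 1) ≤ 8 * α * B ^ 2 - 2 * B * R (k + 1) := by
    intro k hk hek
    have h1 := hnear k hk hek
    -- For a large radius, EBC puts the next iterate within half of it. For a small one, the
    -- guarantee `B * R k` is already of order `α * B ^ 2`.
    rcases le_or_gt (4 * α * B) (R k) with h | h
    · left
      refine abs_le_of_sq_le_sq' ?_ (hR0 _) |>.2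
      refine (heD _).trans ?_
      rw [hR]
      nlinarith [mul_le_mul_of_nonneg_left h1 hα.le, mul_le_mul_of_nonneg_right h (hR0 k)]
    · right
      rw [hR]
      nlinarith [mul_le_mul_of_nonneg_left h.le hB]
  -- As the radii halve, `D k + 2 * B * R k` does not increase in a far stage, so its bound persists
  -- until a near stage starts again.
  have hinv : ∀ k ≤ m, e k ≤ R k ∨ D k ≤ 8 * α * B ^ 2 - 2 * B * R k := by
    intro k
    induction k with
    | zero => exact fun _ => Or.inl h0
    | succ k ih =>
      intro hk
      rcases le_or_gt (e k) (R k) with h | h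
      · exact hcases k (by omega) h
      · rcases ih (by omega) with h' | h'
        · exact absurd h' (not_le.2 h)
        · right
          have := hfar k (by omega) h
          rw [hR]
          linarith
  obtain ⟨k, rfl⟩ : ∃ k, m = k + 1 := ⟨m - 1, by omega⟩
  rcases le_or_gt (e k) (R k) with h | h
  · refine le_max_of_le_right ((hnear k (by omega) h).trans_eq ?_)
    rw [hR]; ring
  · rcases hinv k (by omega) with h' | h'
    · exact absurd h' (not_le.2 h)
    · refine le_max_of_le_left ?_
      have h1 := hfar k (by omega) h
      have h2 := mul_nonneg hB (hR0 k)
      linarith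

theorem four_le_log {n : ℕ} (hn : 100 ≤ n) : 4 ≤ Real.log n := by
  have h1 : Real.log ((2 : ℝ) ^ 6) ≤ Real.log n := by
    refine Real.log_le_log (by positivity) ?_
    have : (100 : ℝ) ≤ n := by exact_mod_cast hn
    norm_num; linarith
  rw [Real.log_pow] at h1
  push_cast at h1
  linarith [Real.log_two_gt_d9]

theorem asaStages_bounds {n : ℕ} (hn : 100 ≤ n) :
    1 ≤ asaStages n ∧ (asaStages n : ℝ) ≤ Real.log n ∧
      √(n / Real.log n) ≤ 4 * 2 ^ asaStages n := by
  have hn' : (100 : ℝ) ≤ n := by exact_mod_cast hn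
  have hlog := four_le_log hn
  have h2a := Real.log_two_gt_d9
  have h2b := Real.log_two_lt_d9
  have h2 : 0 < Real.log 2 := by linarith
  set x : ℝ := 2 * n / Real.logb 2 n with hx
  have hxe : x = 2 * n * Real.log 2 / Real.log n := by
    rw [hx, Real.logb, div_div_eq_mul_div]
  have hx16 : 16 ≤ x := by
    -- Tangent line of the logarithm at 64.
    have h1 : Real.log n ≤ n / 64 + 3.2 := by
      have h3 : Real.log (n / 64) ≤ n / 64 - 1 := Real.log_le_sub_one_of_pos (by positivity)
      rw [Real.log_div (by positivity) (by norm_num)] at h3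
      have h4 : Real.log 64 = 6 * Real.log 2 := by
        rw [show (64 : ℝ) = 2 ^ 6 by norm_num, Real.log_pow]; norm_num
      linarith
    rw [hxe, le_div_iff₀ (by linarith)]
    nlinarith
  have hx0 : 0 < x := by linarith
  have hxlow : n / Real.log n ≤ x := by
    rw [hxe]
    gcongr
    nlinarith
  have hxup : x ≤ 2 * n := by
    rw [hxe, div_le_iff₀ (by linarith)]
    gcongr
    linarith
  set q : ℝ := 1 / 2 * Real.logb 2 x with hq
  -- Makes the truncated subtraction in `asaStages` genuine and leaves at least one stage.
  have hq2 : 2 ≤ q := by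
    have : (4 : ℝ) ≤ Real.logb 2 x := by
      rw [Real.le_logb_iff_rpow_le one_lt_two hx0]
      norm_num
      exact hx16
    rw [hq]; linarith
  have hfl : 2 ≤ ⌊q⌋₊ := Nat.le_floor (by exact_mod_cast hq2)
  have hm : asaStages n = ⌊q⌋₊ - 1 := rfl
  have hmq : (asaStages n : ℝ) + 1 ≤ q := by
    have : asaStages n + 1 = ⌊q⌋₊ := by omega
    calc ((asaStages n : ℝ) + 1) = (⌊q⌋₊ : ℝ) := by exact_mod_cast this
      _ ≤ q := Nat.floor_le (by linarith)
  have hqm : q < (asaStages n : ℝ) + 2 := by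
    have : ⌊q⌋₊ + 1 = asaStages n + 2 := by omega
    calc q < (⌊q⌋₊ : ℝ) + 1 := Nat.lt_floor_add_one q
      _ = _ := by exact_mod_cast this
  refine ⟨by omega, ?_, ?_⟩
  · have h1 : 2 * ((asaStages n : ℝ) + 1) ≤ Real.logb 2 x := by rw [hq] at hmq; linarith
    have h3 : Real.log x ≤ Real.log 2 + Real.log n := by
      rw [← Real.log_mul two_ne_zero (by positivity)]
      exact Real.log_le_log hx0 hxup
    rw [Real.logb, le_div_iff₀ h2] at h1
    have h0 : (0 : ℝ) ≤ asaStages n := Nat.cast_nonneg _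
    nlinarith
  · have h1 : Real.logb 2 x < ((2 * (asaStages n + 2) : ℕ) : ℝ) := by
      push_cast; rw [hq] at hqm; linarith
    rw [Real.logb_lt_iff_lt_rpow one_lt_two hx0, Real.rpow_natCast] at h1
    rw [Real.sqrt_le_left (by positivity)]
    calc n / Real.log n ≤ x := hxlow
      _ ≤ 2 ^ (2 * (asaStages n + 2)) := h1.le
      _ = _ := by ring

theorem asaSteps_bound {n : ℕ} (hn : 100 ≤ n) :
    n / Real.log n ≤ (asaSteps n : ℝ) + 1 := by
  obtain ⟨h1, h2, -⟩ := asaStages_bounds hn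
  have hm : (0 : ℝ) < asaStages n := by exact_mod_cast h1
  have h3 : (n : ℝ) ≤ ((asaSteps n : ℝ) + 1) * asaStages n := by
    have h4 : n < asaSteps n * asaStages n + asaStages n := Nat.lt_div_mul_add (by omega)
    have h5 : (n : ℝ) < asaSteps n * asaStages n + asaStages n := by exact_mod_cast h4
    linarith
  have hlog := four_le_log hn
  rw [div_le_iff₀ (by linarith)]
  exact h3.trans (by gcongr)

/-- The final numerical estimate for adaptive stochastic approximation. -/
theorem asa_rate_le {n : ℕ} (hn : 100 ≤ n) {α G R₀ L : ℝ} (hα : 0 < α) (hG : 0 < G)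
    (hR₀ : 0 ≤ R₀) (hL : 1 ≤ L) :
    max (8 * α * (7 * G * √L / √((asaSteps n : ℝ) + 1)) ^ 2)
      (2 * (7 * G * √L / √((asaSteps n : ℝ) + 1)) * (R₀ / 2 ^ asaStages n)) ≤
      400 * (max (α * G ^ 2) (R₀ * G) * (Real.log n * L) / n) := by
  obtain ⟨-, -, hst⟩ := asaStages_bounds hn
  have hN := asaSteps_bound hn
  have hlog := four_le_log hn
  have hn0 : (0 : ℝ) < n := by positivity
  have hLsq : √L ^ 2 = L := Real.sq_sqrt (by linarith)
  have hLle : √L ≤ L := by rw [Real.sqrt_le_left (by linarith)]; nlinarith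
  set ρ := (n : ℝ) / Real.log n with hρ
  have hρ0 : 0 < ρ := by positivity
  have hρi : Real.log n * L / n = L / ρ := by rw [hρ]; field_simp
  have hNsq : √((asaSteps n : ℝ) + 1) ^ 2 = asaSteps n + 1 := Real.sq_sqrt (by positivity)
  have hsq : √ρ ^ 2 = ρ := Real.sq_sqrt hρ0.le
  have hsρ : 0 < √ρ := Real.sqrt_pos.2 hρ0
  have hNρ : √ρ ≤ √((asaSteps n : ℝ) + 1) := Real.sqrt_le_sqrt hN
  rw [mul_div_assoc (max _ _), hρi]
  have hLρ : 0 ≤ L / ρ := by positivity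
  refine max_le ?_ ?_
  · calc 8 * α * (7 * G * √L / √((asaSteps n : ℝ) + 1)) ^ 2
        = 392 * (α * G ^ 2) * (L / (asaSteps n + 1)) := by
          rw [div_pow, mul_pow, hLsq, hNsq]; ring
      _ ≤ 400 * max (α * G ^ 2) (R₀ * G) * (L / ρ) := by
          gcongr
          · norm_num
          · exact le_max_left _ _
      _ = _ := by ring
  · calc 2 * (7 * G * √L / √((asaSteps n : ℝ) + 1)) * (R₀ / 2 ^ asaStages n)
        ≤ 2 * (7 * G * L / √ρ) * (R₀ / (√ρ / 4)) := by
          gcongr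
          linarith
      _ = 56 * (R₀ * G) * (L / √ρ ^ 2) := by field_simp; ring
      _ = 56 * (R₀ * G) * (L / ρ) := by rw [hsq]
      _ ≤ 400 * max (α * G ^ 2) (R₀ * G) * (L / ρ) := by
          gcongr
          · norm_num
          · exact le_max_right _ _
      _ = _ := by ring

end Parameters

/-! ### Adaptive stochastic approximation. -/

section Asa

variable {E : Type*} [NormedAddCommGroup E] [InnerProductSpace ℝ E] {Z : Type*} {W : Set E}
  {g : E → Z → E} {G R₀ : ℝ} {n : ℕ} {w₁ : E}

theorem asaIter_succ_mem (hWc : IsCompact W) (hW : Convex ℝ W) (hR₀ : 0 ≤ R₀) {z : ℕ → Z} {k : ℕ}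
    (hk : asaIter g W G R₀ n w₁ z k ∈ W) :
    asaIter g W G R₀ n w₁ z (k + 1) ∈
      W ∩ Metric.closedBall (asaIter g W G R₀ n w₁ z k) (R₀ / 2 ^ k) :=
  ssg_mem (hWc.inter_right Metric.isClosed_closedBall) (hW.inter (convex_closedBall _ _))
    (show _ ∈ _ from ⟨hk, Metric.mem_closedBall_self (by positivity)⟩) _ _

theorem asaIter_mem (hWc : IsCompact W) (hW : Convex ℝ W) (hR₀ : 0 ≤ R₀) (hw₁ : w₁ ∈ W)
    (z : ℕ → Z) (k : ℕ) : asaIter g W G R₀ n w₁ z k ∈ W := by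
  induction k with
  | zero => exact hw₁
  | succ k ih => exact (asaIter_succ_mem hWc hW hR₀ ih).1

theorem asaIter_eq_of_radius_zero (hWc : IsCompact W) (hW : Convex ℝ W) (hw₁ : w₁ ∈ W)
    (z : ℕ → Z) (k : ℕ) : asaIter g W G 0 n w₁ z k = w₁ := by
  induction k with
  | zero => rfl
  | succ k ih =>
    have h := (asaIter_succ_mem hWc hW le_rfl
      (asaIter_mem (g := g) (G := G) (n := n) hWc hW le_rfl hw₁ z k)).2
    rw [zero_div, Metric.closedBall_zero, Set.mem_singleton_iff] at h
    rw [h, ih]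

/-- Adaptedness: the start of stage `k` is independent of the samples drawn from then on. -/
theorem asaIter_update {k i : ℕ} (hi : k * asaSteps n ≤ i) (z : ℕ → Z) (x : Z) :
    asaIter g W G R₀ n w₁ (Function.update z i x) k = asaIter g W G R₀ n w₁ z k := by
  induction k with
  | zero => rfl
  | succ k ih =>
    rw [add_mul, one_mul] at hi
    simp only [asaIter]
    rw [ih (by omega)]
    exact ssg_congr fun j hj => Function.update_of_ne (by omega) _ _

variable [FiniteDimensional ℝ E] [MeasurableSpace E] [BorelSpace E] [MeasurableSpace Z]

theorem measurable_asaIter (hWc : IsCompact W) (hW : Convex ℝ W)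
    (hg : Measurable (Function.uncurry g)) (hR₀ : 0 < R₀) (hw₁ : w₁ ∈ W) (k : ℕ) :
    Measurable fun z : ℕ → Z => asaIter g W G R₀ n w₁ z k := by
  induction k with
  | zero => exact measurable_const
  | succ k ih =>
    exact measurable_ssg hWc hW (by positivity) hg ih
      (fun z => asaIter_mem hWc hW hR₀.le hw₁ z k) _ _ _

variable {μ : Measure Z} [IsProbabilityMeasure μ] {f : E → Z → ℝ}

/-- Adaptive stochastic approximation has the rate `log n log (log n / δ) / n` under the error
bound condition with exponent one. -/
theorem iidLaw_asa_le (hWc : IsCompact W) (hf : ∀ w ∈ W, Integrable (f w) μ) (hG0 : 0 < G)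
    (hG : IsLipschitzLoss f W G) (hcont : ContinuousOn (risk μ f) W)
    (hP : ConvexOn ℝ W (risk μ f)) {α : ℝ} (hα : 0 < α) (hebc : EBC (risk μ f) W 1 α)
    (hg : IsSubgradientOracle μ f W G g) (hw₁ : w₁ ∈ W)
    (hv : ∃ v, IsNearest (argminOn (risk μ f) W) w₁ v ∧ ‖w₁ - v‖ ≤ R₀) (hn : 100 ≤ n) {δ : ℝ}
    (hδ : 0 < δ) (hδ1 : δ < 1) :
    iidLaw μ {z | 400 * (max (α * G ^ 2) (R₀ * G) *
        (Real.log n * Real.log (Real.log n / δ)) / n) <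
      risk μ f (asa g W G R₀ n w₁ z) - minValue (risk μ f) W} ≤ ENNReal.ofReal δ := by
  classical
  obtain ⟨v₀, hv₀, hv₀R⟩ := hv
  have hR₀ : 0 ≤ R₀ := (norm_nonneg _).trans hv₀R
  have hlog := four_le_log hn
  obtain ⟨hm1, hmlog, -⟩ := asaStages_bounds hn
  set L := Real.log (Real.log n / δ) with hL
  have hlδ : Real.log n ≤ Real.log n / δ := by
    rw [le_div_iff₀ hδ]
    nlinarith
  have hL1 : 1 ≤ L := by
    rw [hL, Real.le_log_iff_exp_le (by linarith)]
    linarith [Real.exp_one_lt_d9]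
  have hexpL : Real.exp (-L) = δ / Real.log n := by
    rw [hL, Real.exp_neg, Real.exp_log (by linarith), inv_div]
  set A := argminOn (risk μ f) W with hA
  have hAmin : ∀ v ∈ A, minValue (risk μ f) W = risk μ f v := fun v hv => minValue_eq hv
  -- The stage bound needs a positive radius. With radius zero the method never leaves `w₁`, which
  -- is then a minimizer.
  rcases hR₀.eq_or_lt with h0 | hR₀'
  · subst h0
    have hw : w₁ = v₀ := by
      rw [← sub_eq_zero, ← norm_eq_zero]
      exact le_antisymm hv₀R (norm_nonneg _)
    have : {z : ℕ → Z | 400 * (max (α * G ^ 2) (0 * G) * (Real.log n * L) / n) <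
        risk μ f (asa g W G 0 n w₁ z) - minValue (risk μ f) W} = ∅ := by
      refine Set.eq_empty_iff_forall_notMem.2 fun z hz => ?_
      change _ < risk μ f (asaIter g W G 0 n w₁ z _) - _ at hz
      rw [asaIter_eq_of_radius_zero hWc hP.1 hw₁, hAmin v₀ hv₀.1, hw, sub_self] at hz
      refine absurd hz (not_lt.2 ?_)
      have : 0 ≤ max (α * G ^ 2) (0 * G) := le_max_of_le_left (by positivity)
      positivity
    rw [this, measure_empty]
    exact zero_le
  have hAc : IsCompact A := isCompact_argminOn hWc hcont
  have hAne : A.Nonempty := ⟨v₀, hv₀.1⟩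
  have hAconv : Convex ℝ A := by
    have : A = {w | w ∈ W ∧ risk μ f w ≤ risk μ f v₀} := by
      ext w
      exact ⟨fun hw => ⟨hw.1, hw.2 _ hv₀.1.1⟩, fun hw => ⟨hw.1, fun u hu =>
        le_trans hw.2 (hv₀.1.2 u hu)⟩⟩
    rw [this]
    exact hP.convex_le _
  have hnear : ∀ x, IsNearest A x (proj A x) := fun x => proj_isNearest_of_isCompact hAc hAne x
  set a : ℕ → (ℕ → Z) → E := fun k z => asaIter g W G R₀ n w₁ z k with ha
  have haW : ∀ k z, a k z ∈ W := fun k z => asaIter_mem hWc hP.1 hR₀ hw₁ z k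
  have ham : ∀ k, Measurable (a k) := fun k => measurable_asaIter hWc hP.1 hg.1 hR₀' hw₁ k
  have hpm : ∀ k, Measurable fun z => proj A (a k z) := fun k =>
    (continuous_proj hAc hAne hAconv).measurable.comp (ham k)
  set R : ℕ → ℝ := fun k => R₀ / 2 ^ k with hR
  have hRpos : ∀ k, 0 < R k := fun k => by positivity
  -- compare with the nearest minimizer if it lies in the ball, else with the centre
  set u : ℕ → (ℕ → Z) → E := fun k z =>
    if ‖a k z - proj A (a k z)‖ ≤ R k then proj A (a k z) else a k z with hu
  have hum : ∀ k, Measurable (u k) := fun k =>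
    Measurable.ite (measurableSet_le ((ham k).sub (hpm k)).norm measurable_const) (hpm k) (ham k)
  have huK : ∀ k z, u k z ∈ W ∩ Metric.closedBall (a k z) (R k) := fun k z => by
    simp only [hu]
    split_ifs with h
    · exact ⟨(hnear _).1.1, by rwa [Metric.mem_closedBall, dist_comm, dist_eq_norm]⟩
    · exact ⟨haW k z, Metric.mem_closedBall_self (hRpos k).le⟩
  have hadep : ∀ k, ∀ i ≥ k * asaSteps n, ∀ z x, a k (Function.update z i x) = a k z :=
    fun k i hi z x => asaIter_update hi z x
  set B := 7 * G * √L / √((asaSteps n : ℝ) + 1) with hB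
  have hB0 : 0 ≤ B := by positivity
  have hstage : ∀ k, iidLaw μ {z | B * R k < risk μ f (a (k + 1) z) - risk μ f (u k z)} ≤
      ENNReal.ofReal (δ / Real.log n) := fun k => by
    rw [← hexpL]
    exact iidLaw_ssg_le hWc hf hG0 hG hP hg (hRpos k) (ham k) (haW k) (hum k) (huK k)
      (t₀ := k * asaSteps n) (hadep k) (fun i hi z x => by simp only [hu, hadep k i hi]) _ hL1
  -- Off the stage events the recursion applies pathwise. There are at most `log n` stages, each
  -- failing with probability at most `δ / log n`.
  have hsub : {z | 400 * (max (α * G ^ 2) (R₀ * G) * (Real.log n * L) / n) <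
      risk μ f (asa g W G R₀ n w₁ z) - minValue (risk μ f) W} ⊆
      ⋃ k ∈ Finset.range (asaStages n),
        {z | B * R k < risk μ f (a (k + 1) z) - risk μ f (u k z)} := by
    intro z hz
    by_contra hcon
    have hgood : ∀ k < asaStages n, risk μ f (a (k + 1) z) - risk μ f (u k z) ≤ B * R k := by
      intro k hk
      by_contra hlt
      exact hcon (Set.mem_biUnion (x := k) (Finset.mem_range.2 hk) (not_le.1 hlt))
    have hle := adaptive_stages_le (D := fun k => risk μ f (a k z) - minValue (risk μ f) W)
      (e := fun k => ‖a k z - proj A (a k z)‖) (R := R) (m := asaStages n) hα hB0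
      (fun k => (hRpos k).le) (fun k => by simp only [hR, pow_succ]; field_simp)
      (fun k => by
        obtain ⟨v, hv, hle⟩ := hebc (a k z) (haW k z)
        rw [Real.rpow_one, ← hAmin v hv.1] at hle
        exact (pow_le_pow_left₀ (norm_nonneg _) ((hnear _).2 v hv.1) 2).trans hle)
      (by
        have h1 : ‖w₁ - proj A w₁‖ ≤ R₀ := ((hnear w₁).2 v₀ hv₀.1).trans hv₀R
        simpa [hR, ha, asaIter] using h1)
      (fun k hk h => by
        have h1 := hgood k hk
        simp only [hu] at h1
        rw [if_pos h, ← hAmin _ (hnear (a k z)).1] at h1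
        exact h1)
      (fun k hk h => by
        have h1 := hgood k hk
        simp only [hu] at h1
        rw [if_neg (not_le.2 h)] at h1
        linarith) hm1
    have hrate := asa_rate_le hn hα hG0 hR₀ hL1
    exact absurd (hle.trans hrate) (not_le.2 hz)
  calc _ ≤ ∑ k ∈ Finset.range (asaStages n),
        iidLaw μ {z | B * R k < risk μ f (a (k + 1) z) - risk μ f (u k z)} :=
        (measure_mono hsub).trans (measure_biUnion_finset_le _ _)
    _ ≤ ∑ _k ∈ Finset.range (asaStages n), ENNReal.ofReal (δ / Real.log n) :=
        Finset.sum_le_sum fun k _ => hstage k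
    _ = ENNReal.ofReal (asaStages n * (δ / Real.log n)) := by
        rw [Finset.sum_const, Finset.card_range, nsmul_eq_mul,
          ENNReal.ofReal_mul (Nat.cast_nonneg _), ENNReal.ofReal_natCast]
    _ ≤ ENNReal.ofReal δ := by
        refine ENNReal.ofReal_le_ofReal ?_
        rw [mul_div_assoc', div_le_iff₀ (by linarith), mul_comm δ]
        gcongr

end Asa

end FastRates

end

/-! ### Assembly of the four statements. -/

theorem corollary2 :
    ∃ (C₁ : ℝ → ℝ → ℝ → ℝ) (C₂ : ℝ) (C₃ : ℝ → ℝ → ℝ → ℝ),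
    ∀ (d : ℕ) (W : Set (EuclideanSpace ℝ (Fin d)))
      (Z : Type*) [MeasurableSpace Z] (μ : MeasureTheory.Measure Z)
      [MeasureTheory.IsProbabilityMeasure μ] (f : EuclideanSpace ℝ (Fin d) → Z → ℝ),
    W.Nonempty → FastRates.IsPolyhedron W → Bornology.IsBounded W →
    (∀ w ∈ W, MeasureTheory.Integrable (f w) μ) →
    FastRates.IsPiecewiseLinearOn (FastRates.risk μ f) W →
    -- the error bound condition with exponent one, and weak sharp minima
    (∃ κ > 0, FastRates.WeakSharpMinima (FastRates.risk μ f) W κ) ∧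
    (∃ α > 0, FastRates.EBC (FastRates.risk μ f) W 1 α) ∧
    ∀ G > 0, FastRates.IsLipschitzLoss f W G →
      -- empirical risk minimization
      (∀ α > 0, FastRates.EBC (FastRates.risk μ f) W 1 α →
        ∀ R, (∀ w ∈ W, ‖w‖ ≤ R) → ∀ n : ℕ, 2 ≤ n → ∀ δ : ℝ, 0 < δ → δ < 1 →
          FastRates.iidLaw μ {z | ∃ w ∈ FastRates.argminOn (FastRates.empRisk f n z) W,
            C₁ α G R * ((d * Real.log n + Real.log (1 / δ)) / n) <
              FastRates.risk μ f w - FastRates.minValue (FastRates.risk μ f) W}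
          ≤ ENNReal.ofReal δ) ∧
      -- adaptive stochastic approximation
      (ConvexOn ℝ W (FastRates.risk μ f) →
        ∀ α > 0, FastRates.EBC (FastRates.risk μ f) W 1 α →
        ∀ g, FastRates.IsSubgradientOracle μ f W G g →
        ∀ w₁ ∈ W, ∀ R₀ : ℝ,
          (∃ v, FastRates.IsNearest (FastRates.argminOn (FastRates.risk μ f) W) w₁ v ∧
            ‖w₁ - v‖ ≤ R₀) →
          ∀ n : ℕ, 100 ≤ n → ∀ δ : ℝ, 0 < δ → δ < 1 →
          FastRates.iidLaw μ {z |
            C₂ * (max (α * G ^ 2) (R₀ * G) *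
                (Real.log n * Real.log (Real.log n / δ)) / n) <
              FastRates.risk μ f (FastRates.asa g W G R₀ n w₁ z) -
                FastRates.minValue (FastRates.risk μ f) W}
          ≤ ENNReal.ofReal δ) ∧
      -- empirical risk minimization with non-negative linear losses
      ((∀ w ∈ W, ∀ z, 0 ≤ f w z) →
        (∀ z, FastRates.IsAffineOn (fun w => f w z) W) →
        ∀ κ > 0, FastRates.WeakSharpMinima (FastRates.risk μ f) W κ →
        ∀ R, (∀ w ∈ W, ‖w‖ ≤ R) → ∀ n : ℕ, 2 ≤ n →
          C₃ κ G R * (d * Real.log n) ≤ n → ∀ δ : ℝ, 0 < δ → δ < 1 →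
          FastRates.iidLaw μ {z | ∃ w ∈ FastRates.argminOn (FastRates.empRisk f n z) W,
            C₃ κ G R * (((d * Real.log n + Real.log (1 / δ)) / n) ^ 2 +
                (d * Real.log n + Real.log (1 / δ)) *
                  FastRates.minValue (FastRates.risk μ f) W / n) <
              FastRates.risk μ f w - FastRates.minValue (FastRates.risk μ f) W}
          ≤ ENNReal.ofReal δ) := by
  refine ⟨FastRates.ermConst, 400, FastRates.sharpConst, ?_⟩
  intro d W Z _ μ _ f hne hpoly hb hf hpl
  have hWc : IsCompact W := Metric.isCompact_of_isClosed_isBounded hpoly.isClosed hb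
  have hcont := hpl.continuousOn hpoly.isClosed
  have hmin := FastRates.argminOn_nonempty hWc hne hcont
  obtain ⟨κ₀, hκ₀, hs₀⟩ := hpl.exists_weakSharpMinima hpoly hb hne
  refine ⟨⟨κ₀, hκ₀, hs₀⟩, hs₀.exists_ebc hb hκ₀, fun G hG hlip => ⟨?_, ?_, ?_⟩⟩
  · intro α hα hebc R hR n hn δ hδ hδ1
    exact FastRates.iidLaw_erm_ebc_le hf hG hlip hmin hα hebc hR hn hδ hδ1
  · intro hP α hα hebc g hg w₁ hw₁ R₀ hv n hn δ hδ hδ1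
    exact FastRates.iidLaw_asa_le hWc hf hG hlip hcont hP hα hebc hg hw₁ hv hn hδ hδ1
  · intro hpos _ κ hκ hs R hR n hn _ δ hδ hδ1
    refine (MeasureTheory.measure_mono ?_).trans
      (FastRates.iidLaw_erm_sharp_le hf hG hlip hmin hκ hs hR hn hδ hδ1)
    rintro z ⟨w, hw, hlt⟩
    refine ⟨w, hw, lt_of_le_of_lt ?_ hlt⟩
    obtain ⟨v, hv⟩ := hmin
    have hR0 : 0 ≤ R := (norm_nonneg _).trans (hR v hv.1)
    have hC := FastRates.sharpConst_nonneg κ hG.le hR0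
    have hmin0 : 0 ≤ FastRates.minValue (FastRates.risk μ f) W := by
      rw [FastRates.minValue_eq hv]
      exact MeasureTheory.integral_nonneg (hpos v hv.1)
    have hlogδ : 0 ≤ Real.log (1 / δ) := Real.log_nonneg (by rw [le_div_iff₀ hδ]; linarith)
    have hlogn : 0 ≤ Real.log n := Real.log_natCast_nonneg n
    exact mul_le_mul_of_nonneg_left (le_add_of_nonneg_right (by positivity)) hC
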